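/- Let $P_1,\dots,P_m\in\mathbb{Z}[y]$ be polynomials with zero constant term that are linearly independent over $\mathbb{Q}$. For a finite field $\mathbb{F}_q$ with $q$ elements (where $q$ is any prime power), let $r_{P_1,\dots,P_m}(\mathbb{F}_q)$ denote the size of the largest subset of $\mathbb{F}_q$ that contains no progression $x,\,x+P_1(y),\dots,x+P_m(y)$ with $x,y\in\mathbb{F}_q$ and $y\neq 0$. Then there are real numbers $c,\gamma,C>0$, depending only on $P_1,\dots,P_m$, such that for every finite field $\mathbb{F}_q$ of characteristic at least $c$, \[ r_{P_1,\dots,P_m}(\mathbb{F}_q)\le C\,q^{1-\gamma}, \] and, for every $A\subset\mathbb{F}_q$, \[ \left|\#\{(x,y)\in\mathbb{F}_q^2 : x,\ x+P_1(y),\dots,x+P_m(y)\in A\}-\frac{|A|^{m+1}}{q^{m-1}}\right|\le C\,q^{2-(m+1)\gamma}. \] -/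

import Mathlib

open Polynomial

namespace PolyProg

/-- The progression `x, x + P₁(y), …, x + P_m(y)` lies in the set `A`. -/
def ProgIn {F : Type*} [Field F] {m : ℕ} (P : Fin m → ℤ[X]) (A : Finset F) (x y : F) : Prop :=
  x ∈ A ∧ ∀ i, x + aeval y (P i) ∈ A

/-- `A` contains no progression `x, x + P₁(y), …, x + P_m(y)` with `y ≠ 0`. -/
def ProgFree {F : Type*} [Field F] {m : ℕ} (P : Fin m → ℤ[X]) (A : Finset F) : Prop :=
  ∀ x y : F, y ≠ 0 → ¬ ProgIn P A x y

open Classical in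
/-- `r_{P₁,…,P_m}(F)`: the size of the largest subset of `F` that contains no progression
`x, x + P₁(y), …, x + P_m(y)` with `y ≠ 0` (the empty set is always such a subset). -/
noncomputable def r {m : ℕ} (P : Fin m → ℤ[X]) (F : Type*) [Field F] [Fintype F] : ℕ :=
  ((Finset.univ : Finset (Finset F)).filter fun A => ProgFree P A).sup Finset.card

open Classical in
/-- The number of pairs `(x, y)` (with `y = 0` allowed) such that
`x, x + P₁(y), …, x + P_m(y)` all lie in `A`. -/
noncomputable def progCount {F : Type*} [Field F] [Fintype F] {m : ℕ} (P : Fin m → ℤ[X])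
    (A : Finset F) : ℕ :=
  ((Finset.univ : Finset (F × F)).filter fun z => ProgIn P A z.1 z.2).card

end PolyProg

/-! The normalized count of progressions in A differs from the (m+1)-st power of the density of A by
O(q^{-1/N}). The proof is Peluse's degree lowering, an induction on the number of polynomials. The
statement that carries it, `Equidist`, admits an extra phase e(Q(y)), with Q zero or outside the
span of the polynomials; without polynomials it is Weyl's bound.

For the inductive step let D have maximal degree. Cauchy–Schwarz replaces f_D by the conjugate of
the dual function G(x), the average over y of the remaining factors at x - D(y). PET induction
(`exists_petBound`) bounds the new average by a Gowers norm of G whose order depends only on the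
number of polynomials and the degree bound.

No inverse theorem beyond U² is needed, because G is an average over y. By `degree_lowering`,
control of the U^s norm of G yields control of the U^{s+1} norm, provided that averages along the
polynomials other than D, twisted by e(ξD(y)) with ξ ≠ 0, are small. They are small by induction,
since linear independence puts ξD outside the span of the others. At U², G correlates with a
character, and that correlation is again an average along one polynomial fewer; it is small unless a
main term is present. Splitting the functions into a mean and a part of mean zero isolates the main
term (`norm_polyAvg_sub_prod_le`). Every step loses only a power, so a power of q is saved. -/

namespace PolyProg

open Finset ComplexConjugate
open scoped BigOperators

universe u

/-! ### Inequalities for averages -/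

section Averages

variable {ι κ : Type*} [Fintype ι] [Fintype κ]

lemma expect_pow_le {a : ι → ℝ} (ha : ∀ i, 0 ≤ a i) (n : ℕ) (hn : n ≠ 0) :
    (𝔼 i, a i) ^ n ≤ 𝔼 i, a i ^ n := by
  rcases isEmpty_or_nonempty ι with h | h
  · simp [hn]
  have hc : (0 : ℝ) < Fintype.card ι := by exact_mod_cast Fintype.card_pos
  have := Real.pow_arith_mean_le_arith_mean_pow (univ : Finset ι)
    (fun _ => (Fintype.card ι : ℝ)⁻¹) a (fun _ _ => by positivity)
    (by simp [hc.ne']) (fun i _ => ha i) n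
  simpa [Fintype.expect_eq_sum_div_card, div_eq_inv_mul, mul_sum] using this

lemma norm_expect_le_expect (f : ι → ℂ) : ‖𝔼 i, f i‖ ≤ 𝔼 i, ‖f i‖ :=
  RCLike.norm_expect_le (K := ℂ)

lemma norm_expect_le_one [Nonempty ι] {f : ι → ℂ} (hf : ∀ i, ‖f i‖ ≤ 1) : ‖𝔼 i, f i‖ ≤ 1 :=
  (norm_expect_le_expect f).trans (expect_le univ_nonempty fun i _ => hf i)

lemma norm_expect_sq_eq (f : ι → ℂ) :
    ((‖𝔼 i, f i‖ ^ 2 : ℝ) : ℂ) = 𝔼 i, 𝔼 j, f i * conj (f j) := by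
  have h : conj (𝔼 j, f j) = 𝔼 j, conj (f j) := map_expect (starRingEnd ℂ) f univ
  rw [← Fintype.expect_mul_expect, ← h, Complex.mul_conj']
  push_cast; rfl

lemma norm_expect_mul_sq_le {b g : ι → ℂ} (hb : ∀ i, ‖b i‖ ≤ 1) :
    ‖𝔼 i, b i * g i‖ ^ 2 ≤ 𝔼 i, ‖g i‖ ^ 2 := by
  have h1 : ‖𝔼 i, b i * g i‖ ≤ 𝔼 i, ‖g i‖ := by
    refine (norm_expect_le_expect _).trans (expect_le_expect fun i _ => ?_)
    rw [norm_mul]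
    exact mul_le_of_le_one_left (norm_nonneg _) (hb i)
  calc ‖𝔼 i, b i * g i‖ ^ 2 ≤ (𝔼 i, ‖g i‖) ^ 2 := by gcongr
    _ ≤ _ := expect_pow_le (fun _ => norm_nonneg _) 2 (by norm_num)

lemma expect_prod_type (f : ι × κ → ℂ) : 𝔼 z, f z = 𝔼 i, 𝔼 j, f (i, j) := by
  rw [← univ_product_univ, expect_product]

variable {G : Type*} [AddCommGroup G] [Fintype G]

lemma expect_add_right {M : Type*} [AddCommMonoid M] [Module ℚ≥0 M] (f : G → M) (a : G) :
    𝔼 x, f (x + a) = 𝔼 x, f x :=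
  Fintype.expect_equiv (Equiv.addRight a) _ _ fun _ => rfl

lemma expect_add_left {M : Type*} [AddCommMonoid M] [Module ℚ≥0 M] (f : G → M) (a : G) :
    𝔼 x, f (a + x) = 𝔼 x, f x :=
  Fintype.expect_equiv (Equiv.addLeft a) _ _ fun _ => rfl

/-- The van der Corput inequality. -/
lemma vanDerCorput {f₀ : G → ℂ} (hf₀ : ∀ x, ‖f₀ x‖ ≤ 1) (g : G → G → ℂ) :
    ‖𝔼 x, 𝔼 y, f₀ x * g x y‖ ^ 2 ≤ 𝔼 h, ‖𝔼 x, 𝔼 y, g x (y + h) * conj (g x y)‖ := by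
  have h1 : ‖𝔼 x, 𝔼 y, f₀ x * g x y‖ ^ 2 ≤ 𝔼 x, ‖𝔼 y, g x y‖ ^ 2 := by
    simp_rw [← mul_expect]
    exact norm_expect_mul_sq_le hf₀
  have h2 : ((𝔼 x, ‖𝔼 y, g x y‖ ^ 2 : ℝ) : ℂ) = 𝔼 h, 𝔼 x, 𝔼 y, g x (y + h) * conj (g x y) := by
    rw [Complex.ofReal_expect, expect_comm (f := fun h x => 𝔼 y, g x (y + h) * conj (g x y))]
    refine expect_congr rfl fun x _ => ?_
    rw [norm_expect_sq_eq, expect_comm (f := fun h y => g x (y + h) * conj (g x y)), expect_comm]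
    refine expect_congr rfl fun y _ => ?_
    exact (expect_add_left (fun z => g x z * conj (g x y)) y).symm
  calc _ ≤ 𝔼 x, ‖𝔼 y, g x y‖ ^ 2 := h1
    _ ≤ ‖((𝔼 x, ‖𝔼 y, g x y‖ ^ 2 : ℝ) : ℂ)‖ := by
        rw [Complex.norm_real]; exact le_abs_self _
    _ ≤ _ := by rw [h2]; exact norm_expect_le_expect _

end Averages

/-! ### Gowers norms and Cauchy–Schwarz on cubes -/

section Gowers

set_option linter.unusedSectionVars false

variable {F : Type u} [AddCommGroup F] [Fintype F]

/-- The multiplicative derivative of `f` in direction `h`. -/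
noncomputable def diff (h : F) (f : F → ℂ) : F → ℂ := fun x => f (x + h) * conj (f x)

/-- `gowersPow k f` is the `2 ^ (k + 1)`-th power of the Gowers `U^{k+1}`-norm of `f`. -/
noncomputable def gowersPow : ℕ → (F → ℂ) → ℝ
  | 0, f => ‖𝔼 x, f x‖ ^ 2
  | k + 1, f => 𝔼 h, gowersPow k (diff h f)

lemma norm_diff_le {f : F → ℂ} (hf : ∀ x, ‖f x‖ ≤ 1) (h x : F) : ‖diff h f x‖ ≤ 1 := by
  rw [diff, norm_mul, RCLike.norm_conj]
  exact mul_le_one₀ (hf _) (norm_nonneg _) (hf _)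

lemma gowersPow_nonneg (k : ℕ) (f : F → ℂ) : 0 ≤ gowersPow k f := by
  induction k generalizing f with
  | zero => exact sq_nonneg _
  | succ k ih => exact expect_nonneg fun h _ => ih _

lemma gowersPow_le_one (k : ℕ) {f : F → ℂ} (hf : ∀ x, ‖f x‖ ≤ 1) : gowersPow k f ≤ 1 := by
  induction k generalizing f with
  | zero => exact pow_le_one₀ (norm_nonneg _) (norm_expect_le_one hf)
  | succ k ih => exact expect_le univ_nonempty fun h _ => ih (norm_diff_le hf h)

lemma gowersPow_translate (k : ℕ) (f : F → ℂ) (a : F) :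
    gowersPow k (fun x => f (x + a)) = gowersPow k f := by
  induction k generalizing f with
  | zero => simp only [gowersPow, expect_add_right f a]
  | succ k ih =>
    refine expect_congr rfl fun h _ => ?_
    rw [← ih (diff h f)]
    congr 1; ext x
    simp only [diff, add_right_comm x a h]

lemma gowersPow_conj (k : ℕ) (f : F → ℂ) :
    gowersPow k (fun x => conj (f x)) = gowersPow k f := by
  induction k generalizing f with
  | zero =>
    have h : conj (𝔼 j, f j) = 𝔼 j, conj (f j) := map_expect (starRingEnd ℂ) f univ
    simp only [gowersPow, ← h, RCLike.norm_conj]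
  | succ k ih =>
    refine expect_congr rfl fun h _ => ?_
    rw [← ih (diff h f)]
    congr 1; ext x
    simp only [diff, map_mul]

lemma norm_expect_sq_eq_diff (f : F → ℂ) :
    ((‖𝔼 x, f x‖ ^ 2 : ℝ) : ℂ) = 𝔼 h, 𝔼 x, diff h f x := by
  rw [norm_expect_sq_eq, expect_comm, expect_comm (f := fun h x => diff h f x)]
  refine expect_congr rfl fun x _ => ?_
  exact (expect_add_left (fun z => f z * conj (f x)) x).symm

/-- Cauchy–Schwarz in the difference variables. This monotonicity lets the branches of the PET
induction be brought to one common norm. -/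
lemma gowersPow_sq_le (k : ℕ) (f : F → ℂ) : gowersPow k f ^ 2 ≤ gowersPow (k + 1) f := by
  induction k generalizing f with
  | zero =>
    have h : ‖𝔼 x, f x‖ ^ 2 ≤ 𝔼 h, ‖𝔼 x, diff h f x‖ := by
      calc ‖𝔼 x, f x‖ ^ 2 ≤ ‖((‖𝔼 x, f x‖ ^ 2 : ℝ) : ℂ)‖ := by
            rw [Complex.norm_real]; exact le_abs_self _
        _ ≤ _ := by rw [norm_expect_sq_eq_diff]; exact norm_expect_le_expect _
    calc (‖𝔼 x, f x‖ ^ 2) ^ 2 ≤ (𝔼 h, ‖𝔼 x, diff h f x‖) ^ 2 := by gcongr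
      _ ≤ _ := expect_pow_le (fun _ => norm_nonneg _) 2 (by norm_num)
  | succ k ih =>
    calc (𝔼 h, gowersPow k (diff h f)) ^ 2 ≤ 𝔼 h, gowersPow k (diff h f) ^ 2 :=
          expect_pow_le (fun _ => gowersPow_nonneg _ _) 2 (by norm_num)
      _ ≤ _ := expect_le_expect fun h _ => ih _

/-- `Vec F k` is the `k`-fold product of `F`. -/
def Vec (F : Type u) : ℕ → Type u
  | 0 => PUnit
  | k + 1 => F × Vec F k

instance Vec.instFintype : (k : ℕ) → Fintype (Vec F k)
  | 0 => inferInstanceAs (Fintype PUnit)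
  | k + 1 => letI := Vec.instFintype k; inferInstanceAs (Fintype (F × Vec F k))

instance Vec.instNonempty : (k : ℕ) → Nonempty (Vec F k)
  | 0 => inferInstanceAs (Nonempty PUnit)
  | k + 1 => letI := Vec.instNonempty k; inferInstanceAs (Nonempty (F × Vec F k))

/-- The sum of the entries. -/
def vsum : (k : ℕ) → Vec F k → F
  | 0, _ => 0
  | k + 1, h => vsum k h.2 + h.1

/-- The iterated multiplicative derivative. -/
noncomputable def diffs : (k : ℕ) → Vec F k → (F → ℂ) → F → ℂ
  | 0, _, f => f
  | k + 1, h, f => diffs k h.2 (diff h.1 f)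

/-- `∏_ω C^{|ω|} K(h^ω)`, where `h^ω` takes its entries from `h` or `h'` as prescribed by `ω`. -/
noncomputable def cube : (k : ℕ) → (Vec F k → ℂ) → Vec F k → Vec F k → ℂ
  | 0, K, h, _ => K h
  | k + 1, K, h, h' => cube k (fun u => K (h.1, u) * conj (K (h'.1, u))) h.2 h'.2

/-- `∑_ω (-1)^{|ω|} φ(h^ω)`. -/
def cubeSum : (k : ℕ) → (Vec F k → F) → Vec F k → Vec F k → F
  | 0, φ, h, _ => φ h
  | k + 1, φ, h, h' => cubeSum k (fun u => φ (h.1, u) - φ (h'.1, u)) h.2 h'.2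

/-- Products of `1`-bounded functions each of which does not depend on one of the coordinates. -/
def Lower : (k : ℕ) → (Vec F k → ℂ) → Prop
  | 0, B => ∀ h, B h = 1
  | k + 1, B => ∃ (b : Vec F k → ℂ) (B' : F → Vec F k → ℂ), (∀ v, ‖b v‖ ≤ 1) ∧
      (∀ t, Lower k (B' t)) ∧ ∀ t v, B (t, v) = b v * B' t v

lemma expect_vec_zero {M : Type*} [AddCommMonoid M] [Module ℚ≥0 M] (f : Vec F 0 → M) :
    𝔼 h, f h = f PUnit.unit :=
  (expect_congr rfl fun _ _ => rfl : 𝔼 h, f h = 𝔼 _h : Vec F 0, f PUnit.unit).trans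
    (Fintype.expect_const _)

lemma expect_vec_succ {M : Type*} [AddCommMonoid M] [Module ℚ≥0 M] {k : ℕ}
    (f : Vec F (k + 1) → M) : 𝔼 h, f h = 𝔼 t, 𝔼 v, f (t, v) := by
  have : (univ : Finset (Vec F (k + 1))) = (univ : Finset F) ×ˢ (univ : Finset (Vec F k)) := rfl
  rw [this]
  exact expect_product univ univ f

lemma Lower.mul {k : ℕ} {B C : Vec F k → ℂ} (hB : Lower k B) (hC : Lower k C) :
    Lower k fun h => B h * C h := by
  induction k with
  | zero => intro h; simp [hB h, hC h]
  | succ k ih =>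
    obtain ⟨b, B', hb, hB', hB⟩ := hB
    obtain ⟨c, C', hc, hC', hC⟩ := hC
    refine ⟨fun v => b v * c v, fun t v => B' t v * C' t v, fun v => ?_, fun t => ih (hB' t) (hC' t),
      fun t v => ?_⟩
    · rw [norm_mul]; exact mul_le_one₀ (hb v) (norm_nonneg _) (hc v)
    · exact (congrArg₂ (· * ·) (hB t v) (hC t v)).trans (by ring)

lemma Lower.conj {k : ℕ} {B : Vec F k → ℂ} (hB : Lower k B) :
    Lower k fun h => conj (B h) := by
  induction k with
  | zero => intro h; simp [hB h]
  | succ k ih =>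
    obtain ⟨b, B', hb, hB', hB⟩ := hB
    refine ⟨fun v => starRingEnd ℂ (b v), fun t v => starRingEnd ℂ (B' t v), fun v => ?_,
      fun t => ih (hB' t), fun t v => ?_⟩
    · rw [RCLike.norm_conj]; exact hb v
    · exact (congrArg (starRingEnd ℂ) (hB t v)).trans (map_mul _ _ _)

lemma diffs_mul {k : ℕ} (v : Vec F k) (f g : F → ℂ) (x : F) :
    diffs k v (fun z => f z * g z) x = diffs k v f x * diffs k v g x := by
  induction k generalizing f g with
  | zero => rfl
  | succ k ih =>
    simp only [diffs]
    rw [← ih]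
    congr 1; ext z; simp only [diff, map_mul]; ring

lemma norm_diffs_le {k : ℕ} (v : Vec F k) {f : F → ℂ} (hf : ∀ x, ‖f x‖ ≤ 1) (x : F) :
    ‖diffs k v f x‖ ≤ 1 := by
  induction k generalizing f with
  | zero => exact hf x
  | succ k ih => exact ih _ (norm_diff_le hf _)

lemma gowersPow_add (j k : ℕ) (f : F → ℂ) :
    gowersPow (j + k) f = 𝔼 v : Vec F k, gowersPow j (diffs k v f) := by
  induction k generalizing f with
  | zero => rw [expect_vec_zero]; rfl
  | succ k ih =>
    rw [expect_vec_succ]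
    exact expect_congr rfl fun t _ => ih _

/-- In the product over the vertices of a cube, every vertex except the top one omits some
direction. `B` collects those factors, which `box_cauchySchwarz` can then eliminate. -/
lemma exists_lower_diffs (k : ℕ) {f : F → ℂ} (hf : ∀ x, ‖f x‖ ≤ 1) (x : F) :
    ∃ B : Vec F k → ℂ, Lower k B ∧ ∀ v, diffs k v f x = B v * f (x + vsum k v) := by
  induction k generalizing f with
  | zero => exact ⟨fun _ => 1, fun _ => rfl, fun v => by simp [diffs, vsum]⟩
  | succ k ih =>
    choose B hB hBf using fun t : F => ih (f := fun z => f (z + t)) (fun z => hf _)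
    refine ⟨fun h => diffs k h.2 (fun z => conj (f z)) x * B h.1 h.2,
      ⟨fun v => diffs k v (fun z => conj (f z)) x, B, fun v => norm_diffs_le v (fun z => ?_) x, hB,
        fun t v => rfl⟩, fun v => ?_⟩
    · rw [RCLike.norm_conj]; exact hf z
    · have : diff v.1 f = fun z => f (z + v.1) * conj (f z) := rfl
      rw [diffs, this, diffs_mul, hBf, vsum, add_assoc]; ring

lemma cube_mul {k : ℕ} (K L : Vec F k → ℂ) (h h' : Vec F k) :
    cube k (fun v => K v * L v) h h' = cube k K h h' * cube k L h h' := by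
  induction k with
  | zero => rfl
  | succ k ih =>
    simp only [cube]
    rw [← ih]
    congr 1; ext z; simp only [map_mul]; ring

lemma cube_one {k : ℕ} (h h' : Vec F k) : cube k (fun _ => 1) h h' = 1 := by
  induction k with
  | zero => rfl
  | succ k ih => simpa [cube] using ih h.2 h'.2

lemma cube_conj {k : ℕ} (K : Vec F k → ℂ) (h h' : Vec F k) :
    cube k (fun v => conj (K v)) h h' = conj (cube k K h h') := by
  induction k with
  | zero => rfl
  | succ k ih =>
    simp only [cube]
    rw [← ih]
    congr 1; ext z; simp only [map_mul]

lemma cube_prod {k : ℕ} {ι : Type*} (s : Finset ι) (K : ι → Vec F k → ℂ) (h h' : Vec F k) :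
    cube k (fun v => ∏ i ∈ s, K i v) h h' = ∏ i ∈ s, cube k (K i) h h' := by
  classical
  induction s using Finset.induction_on with
  | empty => simpa using cube_one h h'
  | insert a s ha ih => simp only [prod_insert ha, cube_mul, ih]

/-- Values and conjugates pair off, which requires dimension at least one. This removes the weight
from cubes of dual functions. -/
lemma cube_const {k : ℕ} {c : ℂ} (hc : ‖c‖ = 1) (h h' : Vec F (k + 1)) :
    cube (k + 1) (fun _ => c) h h' = 1 := by
  have : c * conj c = 1 := by rw [Complex.mul_conj', hc]; simp
  simp only [cube, this]
  exact cube_one _ _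

lemma norm_cube_le {k : ℕ} {K : Vec F k → ℂ} (hK : ∀ v, ‖K v‖ ≤ 1) (h h' : Vec F k) :
    ‖cube k K h h'‖ ≤ ‖K h‖ := by
  induction k with
  | zero => exact le_rfl
  | succ k ih =>
    refine (ih (fun v => ?_) _ _).trans ?_
    · rw [norm_mul, RCLike.norm_conj]; exact mul_le_one₀ (hK _) (norm_nonneg _) (hK _)
    · rw [norm_mul, RCLike.norm_conj]; exact mul_le_of_le_one_right (norm_nonneg _) (hK _)

lemma cubeSum_sub {k : ℕ} (φ φ' : Vec F k → F) (h h' : Vec F k) :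
    cubeSum k (fun v => φ v - φ' v) h h' = cubeSum k φ h h' - cubeSum k φ' h h' := by
  induction k with
  | zero => rfl
  | succ k ih =>
    simp only [cubeSum]
    rw [← ih]
    congr 1; ext z; abel

/-- The Cauchy–Schwarz inequality that eliminates all functions not depending on some coordinate. -/
lemma box_cauchySchwarz (k : ℕ) {X : Type u} [Fintype X] (B K : X → Vec F k → ℂ)
    (hB : ∀ x, Lower k (B x)) :
    ‖𝔼 x, 𝔼 h, B x h * K x h‖ ^ (2 ^ k) ≤ ‖𝔼 x, 𝔼 h, 𝔼 h', cube k (K x) h h'‖ := by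
  induction k generalizing X with
  | zero =>
    simp only [expect_vec_zero, cube, pow_zero, pow_one]
    simp only [fun x => hB x PUnit.unit, one_mul, le_refl]
  | succ k ih =>
    choose b B' hb hB' hBB using hB
    -- Cauchy–Schwarz drops `b`, which does not see the first coordinate. The two copies of that
    -- coordinate join the outer variable, so the induction continues over `X × F × F`.
    have h1 : ‖𝔼 x, 𝔼 h, B x h * K x h‖ ^ 2 ≤
        ‖𝔼 z : X × F × F, 𝔼 v, (B' z.1 z.2.1 v * conj (B' z.1 z.2.2 v)) *
          (K z.1 (z.2.1, v) * conj (K z.1 (z.2.2, v)))‖ := by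
      have e1 : 𝔼 x, 𝔼 h, B x h * K x h =
          𝔼 z : X × Vec F k, b z.1 z.2 * 𝔼 t, B' z.1 t z.2 * K z.1 (t, z.2) := by
        rw [expect_prod_type]
        refine expect_congr rfl fun x _ => ?_
        rw [expect_vec_succ, expect_comm]
        refine expect_congr rfl fun v _ => ?_
        rw [mul_expect]
        refine expect_congr rfl fun t _ => ?_
        rw [hBB, mul_assoc]
      have e2 : ((𝔼 z : X × Vec F k, ‖𝔼 t, B' z.1 t z.2 * K z.1 (t, z.2)‖ ^ 2 : ℝ) : ℂ) =
          𝔼 z : X × F × F, 𝔼 v, (B' z.1 z.2.1 v * conj (B' z.1 z.2.2 v)) *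
          (K z.1 (z.2.1, v) * conj (K z.1 (z.2.2, v))) := by
        rw [Complex.ofReal_expect, expect_prod_type, expect_prod_type]
        refine expect_congr rfl fun x _ => ?_
        rw [expect_prod_type]
        simp only
        rw [expect_congr rfl fun t _ => expect_comm _ _ _, expect_comm (s := univ (α := F))]
        refine expect_congr rfl fun v _ => ?_
        rw [norm_expect_sq_eq]
        refine expect_congr rfl fun t _ => expect_congr rfl fun t' _ => ?_
        rw [map_mul]; ring
      rw [e1]
      calc _ ≤ 𝔼 z : X × Vec F k, ‖𝔼 t, B' z.1 t z.2 * K z.1 (t, z.2)‖ ^ 2 :=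
            norm_expect_mul_sq_le fun z => hb _ _
        _ ≤ ‖((𝔼 z : X × Vec F k, ‖𝔼 t, B' z.1 t z.2 * K z.1 (t, z.2)‖ ^ 2 : ℝ) : ℂ)‖ := by
            rw [Complex.norm_real]; exact le_abs_self _
        _ = _ := by rw [e2]
    rw [pow_succ' 2 k, pow_mul]
    refine (pow_le_pow_left₀ (by positivity) h1 _).trans ?_
    refine (ih _ _ fun z => (hB' _ _).mul (hB' _ _).conj).trans (le_of_eq ?_)
    congr 1
    rw [expect_prod_type]
    refine expect_congr rfl fun x _ => ?_
    rw [expect_prod_type, expect_vec_succ]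
    refine expect_congr rfl fun t _ => ?_
    rw [expect_comm]
    refine expect_congr rfl fun v _ => ?_
    rw [expect_vec_succ]
    rfl

/-- After a translation in `x`, only the differences of corresponding entries of `h` and `h'`
matter, and these are the directions of the Gowers norm. -/
lemma expect_norm_sq_cube (k : ℕ) (f : F → ℂ) :
    𝔼 h, 𝔼 h', ‖𝔼 x, cube k (fun v => f (x + vsum k v)) h h'‖ ^ 2 = gowersPow k f := by
  induction k generalizing f with
  | zero => simp [cube, vsum, gowersPow]
  | succ k ih =>
    have key : ∀ t t' : F, 𝔼 v, 𝔼 v', ‖𝔼 x, cube (k + 1) (fun v => f (x + vsum (k + 1) v))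
        (t, v) (t', v')‖ ^ 2 = gowersPow k (diff (t - t') f) := by
      intro t t'
      rw [← gowersPow_translate k _ t', ← ih]
      refine expect_congr rfl fun v _ => expect_congr rfl fun v' _ => ?_
      congr 2
      refine expect_congr rfl fun x _ => ?_
      simp only [cube, vsum, diff]
      congr 1; ext u
      rw [show x + (vsum k u + t) = x + vsum k u + t' + (t - t') by abel, add_assoc x _ t']
    rw [expect_vec_succ]
    simp only [expect_vec_succ (k := k) (f := fun _ => _)]
    have e : ∀ t : F, (𝔼 v, 𝔼 t', 𝔼 v', ‖𝔼 x, cube (k + 1) (fun v => f (x + vsum (k + 1) v))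
        (t, v) (t', v')‖ ^ 2) = gowersPow (k + 1) f := by
      intro t
      rw [expect_comm]
      simp only [key]
      exact Fintype.expect_equiv (Equiv.subLeft t) _ _ fun _ => rfl
    rw [expect_congr rfl fun t _ => e t]
    exact Fintype.expect_const _

end Gowers

/-! ### Fourier analysis and degree lowering -/

section DegreeLowering

set_option linter.unusedSectionVars false

variable {F : Type u} [Field F] [Fintype F] (e : AddChar F ℂ)

lemma char_mul_conj (a b : F) : e a * conj (e b) = e (a - b) := by
  rw [← AddChar.map_neg_eq_conj, ← AddChar.map_add_eq_mul, sub_eq_add_neg]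

/-- The subtraction cancels the vertex `h` of the alternating sum. Every other vertex takes some
coordinate from the fixed `h'`, hence does not depend on that coordinate of `h`. -/
lemma lower_char (k : ℕ) (φ : Vec F k → F) (h' : Vec F k) (z : F) :
    Lower k fun h => e ((φ h - cubeSum k φ h h') * z) := by
  induction k with
  | zero => intro h; simp [cubeSum]
  | succ k ih =>
    refine ⟨fun v => e (cubeSum k (fun u => φ (h'.1, u)) v h'.2 * z),
      fun t v => e ((φ (t, v) - cubeSum k (fun u => φ (t, u)) v h'.2) * z), fun v => ?_,
      fun t => ih _ _, fun t v => ?_⟩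
    · rw [AddChar.norm_apply]
    · simp only [cubeSum]
      rw [← AddChar.map_add_eq_mul, cubeSum_sub]
      congr 1; ring

lemma cube_char (k : ℕ) (φ : Vec F k → F) (h h' : Vec F k) (z : F) :
    cube k (fun v => e (φ v * z)) h h' = e (cubeSum k φ h h' * z) := by
  induction k with
  | zero => rfl
  | succ k ih => simp only [cube, cubeSum, char_mul_conj, ← sub_mul, ← ih]

lemma cubeSum_zero (k : ℕ) (h h' : Vec F k) : cubeSum k (fun _ => (0 : F)) h h' = 0 := by
  induction k with
  | zero => rfl
  | succ k ih => simp only [cubeSum, sub_zero, ih]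

/-- The dual–difference interchange. -/
lemma dual_difference_interchange (k : ℕ) {g : F → F → ℂ} (hg : ∀ y x, ‖g y x‖ ≤ 1)
    {c : Vec F k → ℝ} (hc : ∀ h, 0 ≤ c h) (hc' : ∀ h, c h ≤ 1) (φ₁ φ₂ : Vec F k → F)
    (hφ₁ : ∀ z, Lower k fun h => e (φ₁ h * z)) :
    (𝔼 h, c h * ‖𝔼 x, diffs k h (fun z => 𝔼 y, g y z) x *
      (e (φ₁ h * x) * e (φ₂ h * x))‖ ^ 2) ^ (2 ^ k) ≤
    𝔼 h, 𝔼 h', c h * ‖𝔼 x, 𝔼 y, cube k (fun v => g y (x + vsum k v)) h h' *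
      e (cubeSum k φ₂ h h' * x)‖ ^ 2 := by
  set G : F → ℂ := fun z => 𝔼 y, g y z with hG
  choose B hB hBG using exists_lower_diffs k (f := G) fun x => norm_expect_le_one fun y => hg y x
  set W : ℝ := 𝔼 h, c h * ‖𝔼 x, diffs k h G x * (e (φ₁ h * x) * e (φ₂ h * x))‖ ^ 2 with hW
  have hW0 : 0 ≤ W := expect_nonneg fun h _ => mul_nonneg (hc h) (sq_nonneg _)
  -- With p = (x, y), `L` holds all that is to be eliminated, while `M` keeps the top vertex with
  -- its average over y unfolded. Squaring duplicates p, and box Cauchy–Schwarz in `h` treats both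
  -- copies as the outer variable; afterwards they recombine into a square.
  let L : F × F → Vec F k → ℂ := fun p h => B p.1 h * e (φ₁ h * p.1)
  let M : F × F → Vec F k → ℂ := fun p h => g p.2 (p.1 + vsum k h) * e (φ₂ h * p.1)
  have hL : ∀ p, Lower k (L p) := fun p => (hB p.1).mul (hφ₁ p.1)
  have e1 : (W : ℂ) = 𝔼 z : (F × F) × (F × F), 𝔼 h, (L z.1 h * conj (L z.2 h)) *
      ((c h : ℂ) * (M z.1 h * conj (M z.2 h))) := by
    rw [hW, Complex.ofReal_expect, expect_comm]
    refine expect_congr rfl fun h _ => ?_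
    have : 𝔼 x, diffs k h G x * (e (φ₁ h * x) * e (φ₂ h * x)) = 𝔼 p, L p h * M p h := by
      rw [expect_prod_type]
      refine expect_congr rfl fun x _ => ?_
      rw [hBG, hG]
      simp only [mul_expect, expect_mul]
      refine expect_congr rfl fun y _ => ?_
      simp only [L, M]; ring
    rw [this, Complex.ofReal_mul, norm_expect_sq_eq]
    refine Eq.trans ?_ (expect_prod_type _).symm
    rw [mul_expect]
    refine expect_congr rfl fun p _ => ?_
    rw [mul_expect]
    refine expect_congr rfl fun p' _ => ?_
    simp only [map_mul (starRingEnd ℂ)]; ring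
  have e2 : ∀ p h h', cube k (M p) h h' =
      cube k (fun v => g p.2 (p.1 + vsum k v)) h h' * e (cubeSum k φ₂ h h' * p.1) := by
    intro p h h'
    rw [← cube_char, ← cube_mul]
  calc W ^ (2 ^ k) = ‖(W : ℂ)‖ ^ (2 ^ k) := by
        rw [Complex.norm_real, Real.norm_of_nonneg hW0]
    _ ≤ ‖𝔼 z : (F × F) × (F × F), 𝔼 h, 𝔼 h', cube k
          (fun h => (c h : ℂ) * (M z.1 h * conj (M z.2 h))) h h'‖ := by
        rw [e1]
        exact box_cauchySchwarz k _ _ fun z => (hL _).mul (hL _).conj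
    _ = ‖𝔼 h, 𝔼 h', cube k (fun h => (c h : ℂ)) h h' *
          ((‖𝔼 p, cube k (M p) h h'‖ ^ 2 : ℝ) : ℂ)‖ := by
        congr 1
        rw [expect_comm]
        refine expect_congr rfl fun h _ => ?_
        rw [expect_comm]
        refine expect_congr rfl fun h' _ => ?_
        rw [norm_expect_sq_eq]
        refine (expect_prod_type _).trans ?_
        rw [mul_expect]
        refine expect_congr rfl fun p _ => ?_
        rw [mul_expect]
        refine expect_congr rfl fun p' _ => ?_
        rw [cube_mul, cube_mul, cube_conj]
    _ ≤ 𝔼 h, 𝔼 h', ‖cube k (fun h => (c h : ℂ)) h h' *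
          ((‖𝔼 p, cube k (M p) h h'‖ ^ 2 : ℝ) : ℂ)‖ :=
        (norm_expect_le_expect _).trans (expect_le_expect fun h _ => norm_expect_le_expect _)
    _ ≤ _ := by
        refine expect_le_expect fun h _ => expect_le_expect fun h' _ => ?_
        rw [norm_mul, Complex.norm_real, Real.norm_of_nonneg (sq_nonneg _), expect_prod_type]
        simp only [e2]
        refine mul_le_mul_of_nonneg_right ?_ (sq_nonneg _)
        refine (norm_cube_le (fun v => ?_) h h').trans ?_
        · rw [Complex.norm_real, Real.norm_of_nonneg (hc v)]; exact hc' v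
        · rw [Complex.norm_real, Real.norm_of_nonneg (hc h)]

/-- The interchange with `g` independent of y and no surviving phase: lower frequencies cost
nothing, and the cubes that remain average to the Gowers norm. -/
lemma expect_lower_phase_le (k : ℕ) {G : F → ℂ} (hG : ∀ x, ‖G x‖ ≤ 1) (φ : Vec F k → F)
    (hφ : ∀ z, Lower k fun h => e (φ h * z)) :
    (𝔼 h, ‖𝔼 x, diffs k h G x * e (φ h * x)‖ ^ 2) ^ (2 ^ k) ≤ gowersPow k G := by
  have := dual_difference_interchange e k (g := fun _ : F => G) (fun _ => hG)
    (c := fun _ => 1) (fun _ => zero_le_one) (fun _ => le_rfl) φ (fun _ => 0) hφ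
  simpa [cubeSum_zero, Fintype.expect_const, expect_norm_sq_cube] using this

variable {e}

open Classical in
lemma sum_char_mul (he : e ≠ 1) (z : F) :
    ∑ ξ, e (ξ * z) = if z = 0 then (Fintype.card F : ℂ) else 0 := by
  rw [AddChar.sum_mulShift z (AddChar.IsPrimitive.of_ne_one he)]
  split_ifs <;> simp

lemma parseval (he : e ≠ 1) (f : F → ℂ) :
    ∑ ξ, ‖𝔼 x, f x * e (ξ * x)‖ ^ 2 = 𝔼 x, ‖f x‖ ^ 2 := by
  apply Complex.ofReal_injective
  rw [Complex.ofReal_sum, Complex.ofReal_expect]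
  have hq : (Fintype.card F : ℂ) ≠ 0 := by exact_mod_cast Fintype.card_ne_zero
  calc ∑ ξ, ((‖𝔼 x, f x * e (ξ * x)‖ ^ 2 : ℝ) : ℂ)
      = ∑ ξ, 𝔼 x, 𝔼 x', f x * conj (f x') * e (ξ * (x - x')) := by
        refine sum_congr rfl fun ξ _ => ?_
        rw [norm_expect_sq_eq]
        refine expect_congr rfl fun x _ => expect_congr rfl fun x' _ => ?_
        rw [map_mul (starRingEnd ℂ), mul_sub, ← char_mul_conj]; ring
    _ = 𝔼 x, 𝔼 x', f x * conj (f x') * ∑ ξ, e (ξ * (x - x')) := by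
        rw [← expect_sum_comm]
        refine expect_congr rfl fun x _ => ?_
        rw [← expect_sum_comm]
        refine expect_congr rfl fun x' _ => ?_
        rw [mul_sum]
    _ = _ := by
        refine expect_congr rfl fun x _ => ?_
        rw [Fintype.expect_eq_sum_div_card, sum_eq_single x]
        · rw [sum_char_mul he, sub_self, if_pos rfl, mul_div_assoc, div_self hq, mul_one,
            Complex.mul_conj']
          push_cast; rfl
        · intro x' _ hx
          rw [sum_char_mul he, if_neg (sub_ne_zero.2 hx.symm), mul_zero]
        · simp

/-- Parseval in `h`: the mean of `diff h f`, as a function of `h`, has the squared absolute values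
of the Fourier coefficients of `f` as its own coefficients. -/
lemma gowersPow_one_eq (he : e ≠ 1) (f : F → ℂ) :
    gowersPow 1 f = ∑ ξ, (‖𝔼 x, f x * e (ξ * x)‖ ^ 2) ^ 2 := by
  have h : gowersPow 1 f = 𝔼 h, ‖𝔼 x, diff h f x‖ ^ 2 := rfl
  rw [h, ← parseval he]
  refine sum_congr rfl fun ξ _ => ?_
  have : 𝔼 h, (𝔼 x, diff h f x) * e (ξ * h) = ((‖𝔼 x, f x * e (ξ * x)‖ ^ 2 : ℝ) : ℂ) := by
    rw [norm_expect_sq_eq_diff]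
    refine expect_congr rfl fun h _ => ?_
    rw [expect_mul]
    refine expect_congr rfl fun x _ => ?_
    have : e (ξ * h) = e (ξ * (x + h)) * conj (e (ξ * x)) := by
      rw [char_mul_conj]; congr 1; ring
    rw [this, diff, diff, map_mul (starRingEnd ℂ)]; ring
  rw [this, Complex.norm_real, Real.norm_of_nonneg (sq_nonneg _)]

/-- The inverse theorem for the `U²`-norm. -/
lemma exists_gowersPow_one_le (he : e ≠ 1) {f : F → ℂ} (hf : ∀ x, ‖f x‖ ≤ 1) :
    ∃ ξ, gowersPow 1 f ≤ ‖𝔼 x, f x * e (ξ * x)‖ ^ 2 := by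
  obtain ⟨ξ, -, hξ⟩ := exists_max_image univ (fun ξ => ‖𝔼 x, f x * e (ξ * x)‖ ^ 2) univ_nonempty
  refine ⟨ξ, ?_⟩
  rw [gowersPow_one_eq he]
  calc ∑ η, (‖𝔼 x, f x * e (η * x)‖ ^ 2) ^ 2
      ≤ ∑ η, ‖𝔼 x, f x * e (ξ * x)‖ ^ 2 * ‖𝔼 x, f x * e (η * x)‖ ^ 2 := by
        refine sum_le_sum fun η _ => ?_
        rw [sq (‖_‖ ^ 2)]
        exact mul_le_mul_of_nonneg_right (hξ η (mem_univ _)) (sq_nonneg _)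
    _ = ‖𝔼 x, f x * e (ξ * x)‖ ^ 2 * 𝔼 x, ‖f x‖ ^ 2 := by rw [← mul_sum, parseval he]
    _ ≤ _ := mul_le_of_le_one_right (sq_nonneg _)
        (expect_le univ_nonempty fun x _ => pow_le_one₀ (norm_nonneg _) (hf x))

/-- Degree lowering for an average `G` of functions `g y`. -/
lemma degree_lowering (he : e ≠ 1) (k : ℕ) {g : F → F → ℂ} (hg : ∀ y x, ‖g y x‖ ≤ 1) {ε : ℝ}
    (hε : 0 ≤ ε)
    (H : ∀ h h' ξ, ξ ≠ 0 →
      ‖𝔼 x, 𝔼 y, cube k (fun v => g y (x + vsum k v)) h h' * e (ξ * x)‖ ^ 2 ≤ ε) :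
    ∃ ρ : ℝ, 0 ≤ ρ ∧ ρ ^ (2 ^ k) ≤ gowersPow k (fun x => 𝔼 y, g y x) ∧
      gowersPow (k + 1) (fun x => 𝔼 y, g y x) ^ (2 ^ (k + 1)) ≤ ρ + ε := by
  classical
  set G : F → ℂ := fun x => 𝔼 y, g y x with hGdef
  have hG : ∀ x, ‖G x‖ ≤ 1 := fun x => norm_expect_le_one fun y => hg y x
  set c : Vec F k → ℝ := fun h => gowersPow 1 (diffs k h G)
  have hc0 : ∀ h, 0 ≤ c h := fun h => gowersPow_nonneg _ _
  have hc1 : ∀ h, c h ≤ 1 := fun h => gowersPow_le_one _ (norm_diffs_le h hG)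
  -- `φ h` is a dominant frequency of the iterated derivative in directions `h`.
  choose φ hφ using fun h : Vec F k => exists_gowersPow_one_le he (norm_diffs_le h hG)
  -- The interchange leaves the single frequency `cubeSum k φ h h'`. Where it is nonzero, `H` gives
  -- ε; where it vanishes, only the trivial bound `c h` is available.
  have h1 : gowersPow (k + 1) G ^ (2 ^ (k + 1)) ≤
      𝔼 h', 𝔼 h, (c h * (if cubeSum k φ h h' = 0 then 1 else 0)) + ε := by
    have h2 : gowersPow (k + 1) G ^ 2 ≤ 𝔼 h, c h * ‖𝔼 x, diffs k h G x *
        (e (0 * x) * e (φ h * x))‖ ^ 2 := by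
      rw [add_comm k 1, gowersPow_add]
      refine (expect_pow_le hc0 2 (by norm_num)).trans (expect_le_expect fun h _ => ?_)
      rw [sq]
      simp only [zero_mul, AddChar.map_zero_eq_one, one_mul]
      exact mul_le_mul_of_nonneg_left (hφ h) (hc0 h)
    have hl : Lower k (fun _ : Vec F k => (1 : ℂ)) := by
      simpa using lower_char e k (fun _ => 0) (Classical.arbitrary _) 0
    have h3 := dual_difference_interchange e k hg hc0 hc1 (fun _ => 0) φ (fun z => by simpa using hl)
    rw [pow_succ' 2 k, pow_mul]
    refine (pow_le_pow_left₀ (sq_nonneg _) h2 _).trans (h3.trans ?_)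
    rw [expect_comm, ← Fintype.expect_const (ι := Vec F k) ε, ← expect_add_distrib]
    refine expect_le_expect fun h' _ => ?_
    rw [← Fintype.expect_const (ι := Vec F k) ε, ← expect_add_distrib]
    refine expect_le_expect fun h _ => ?_
    split_ifs with h0
    · rw [mul_one]
      refine le_add_of_le_of_nonneg (mul_le_of_le_one_right (hc0 h) (pow_le_one₀ (norm_nonneg _) ?_)) hε
      refine norm_expect_le_one fun x => norm_expect_le_one fun y => ?_
      rw [norm_mul, AddChar.norm_apply, mul_one]
      exact (norm_cube_le (fun v => hg _ _) _ _).trans (hg _ _)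
    · rw [mul_zero, zero_add]
      exact (mul_le_of_le_one_left (sq_nonneg _) (hc1 h)).trans (H _ _ _ h0)
  -- Fix a favourable `h'`. Where the alternating sum vanishes, `φ h` equals `φ h - cubeSum k φ h
  -- h'`, whose phase is `Lower`; hence the Gowers norm of one order less takes over.
  obtain ⟨h', -, hh'⟩ := exists_le_of_le_expect univ_nonempty
    (le_refl (𝔼 h', 𝔼 h, (c h * (if cubeSum k φ h h' = 0 then 1 else 0))))
  refine ⟨𝔼 h, (c h * (if cubeSum k φ h h' = 0 then 1 else 0)),
    expect_nonneg fun h _ => mul_nonneg (hc0 h) (by split_ifs <;> norm_num), ?_,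
    h1.trans (by gcongr)⟩
  refine le_trans (pow_le_pow_left₀ (expect_nonneg fun h _ => mul_nonneg (hc0 h)
    (by split_ifs <;> norm_num)) ?_ _)
    (expect_lower_phase_le e k hG (fun h => φ h - cubeSum k φ h h') (lower_char e k φ h'))
  refine expect_le_expect fun h _ => ?_
  split_ifs with h0
  · rw [mul_one]
    simpa [h0] using hφ h
  · rw [mul_zero]; exact sq_nonneg _

end DegreeLowering

/-! ### Linear families and van der Corput for polynomial families -/

section Families

set_option linter.unusedSectionVars false

lemma gowersPow_expect_dilate {F : Type u} [Field F] [Fintype F] (k : ℕ) (f : F → ℂ) {a : F}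
    (ha : a ≠ 0) : 𝔼 h, gowersPow k (diff (a * h) f) = gowersPow (k + 1) f :=
  Fintype.expect_equiv (Equiv.mulLeft₀ a ha) _ _ fun _ => rfl

lemma norm_mul_conj_le_one {a b : ℂ} (ha : ‖a‖ ≤ 1) (hb : ‖b‖ ≤ 1) : ‖a * conj b‖ ≤ 1 := by
  rw [norm_mul, RCLike.norm_conj]
  exact mul_le_one₀ ha (norm_nonneg _) hb

lemma norm_prod_le_one {ι : Type*} {s : Finset ι} {f : ι → ℂ} (hf : ∀ i, ‖f i‖ ≤ 1) :
    ‖∏ i ∈ s, f i‖ ≤ 1 := by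
  rw [norm_prod]
  exact prod_le_one (fun _ _ => norm_nonneg _) fun i _ => hf i

/-- Averages along linear families with distinct slopes are controlled by Gowers norms. -/
lemma linear_family_bound {F : Type u} [Field F] [Fintype F] {ι : Type*} [DecidableEq ι] (n : ℕ)
    (T : Finset ι) (hT : T.card = n + 1) (a : ι → F) (ha : Set.InjOn a T) {i₀ : ι} (hi₀ : i₀ ∈ T)
    {w : F → ℂ} (hw : ∀ y, ‖w y‖ ≤ 1) {f : ι → F → ℂ} (hf : ∀ i x, ‖f i x‖ ≤ 1) :
    ‖𝔼 x, 𝔼 y, w y * ∏ i ∈ T, f i (x + a i * y)‖ ^ (2 ^ (n + 1)) ≤ gowersPow n (f i₀) := by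
  induction n generalizing T w f with
  | zero =>
    obtain ⟨i, rfl⟩ := card_eq_one.1 hT
    obtain rfl := mem_singleton.1 hi₀
    simp only [prod_singleton, zero_add, pow_one, gowersPow]
    rw [expect_comm]
    simp only [← mul_expect, expect_add_right (f i₀), ← expect_mul]
    rw [norm_mul]
    gcongr
    exact mul_le_of_le_one_left (norm_nonneg _) (norm_expect_le_one hw)
  | succ n ih =>
    obtain ⟨b, hb, hbi⟩ := exists_mem_ne (by omega : 1 < T.card) i₀
    -- Translating x by `-a b * y` frees `f b` from y, so van der Corput removes it. The translation
    -- is undone afterwards: the slopes stay `a i`, and `f i` is differentiated in direction `(a i -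
    -- a b) * h`.
    set g : F → F → ℂ := fun x y => w y * ∏ i ∈ T.erase b, f i (x + (a i - a b) * y) with hg
    have e1 : 𝔼 x, 𝔼 y, w y * ∏ i ∈ T, f i (x + a i * y) = 𝔼 x, 𝔼 y, f b x * g x y := by
      rw [expect_comm, expect_comm (f := fun x y => f b x * g x y)]
      refine expect_congr rfl fun y _ => ?_
      rw [← expect_add_right (fun x => f b x * g x y) (a b * y)]
      refine expect_congr rfl fun x _ => ?_
      rw [← mul_prod_erase T _ hb, hg, mul_left_comm]
      congr 2
      refine prod_congr rfl fun i _ => ?_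
      congr 1; ring
    have e2 : ∀ h, 𝔼 x, 𝔼 y, g x (y + h) * conj (g x y) = 𝔼 x, 𝔼 y, (w (y + h) * conj (w y)) *
        ∏ i ∈ T.erase b, diff ((a i - a b) * h) (f i) (x + a i * y) := by
      intro h
      rw [expect_comm, expect_comm (f := fun x y => (w (y + h) * conj (w y)) *
        ∏ i ∈ T.erase b, diff ((a i - a b) * h) (f i) (x + a i * y))]
      refine expect_congr rfl fun y _ => ?_
      rw [← expect_add_right (fun x => g x (y + h) * conj (g x y)) (a b * y)]
      refine expect_congr rfl fun x _ => ?_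
      simp only [hg, map_mul, map_prod, diff, prod_mul_distrib]
      have h1 : ∀ i, x + a b * y + (a i - a b) * (y + h) = x + a i * y + (a i - a b) * h :=
        fun i => by ring
      have h2 : ∀ i, x + a b * y + (a i - a b) * y = x + a i * y := fun i => by ring
      simp only [h1, h2]; ring
    have h1 := vanDerCorput (hf b) g
    simp only [e2] at h1
    rw [e1, pow_succ' 2 (n + 1), pow_mul]
    refine (pow_le_pow_left₀ (sq_nonneg _) h1 _).trans ?_
    refine (expect_pow_le (fun _ => norm_nonneg _) _ (by positivity)).trans ?_
    have hab : a i₀ - a b ≠ 0 := sub_ne_zero.2 fun h => hbi (ha hi₀ hb h).symm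
    rw [← gowersPow_expect_dilate n (f i₀) hab]
    refine expect_le_expect fun h _ => ?_
    exact ih (T.erase b) (by rw [card_erase_of_mem hb, hT]; rfl)
      (ha.mono (by simp)) (mem_erase.2 ⟨hbi.symm, hi₀⟩)
      (fun y => norm_mul_conj_le_one (hw _) (hw _)) (fun i => norm_diff_le (hf i) _)

variable {F : Type u} [Field F] [Fintype F]

/-- The average of `f₀(x) w(y) ∏_{P ∈ S} f_P(x + P(y))`. -/
noncomputable def polyAvg (S : Finset F[X]) (w f₀ : F → ℂ) (f : F[X] → F → ℂ) : ℂ :=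
  𝔼 x, 𝔼 y, f₀ x * (w y * ∏ P ∈ S, f P (x + P.eval y))

lemma norm_polyAvg_le_one (S : Finset F[X]) {w f₀ : F → ℂ} {f : F[X] → F → ℂ}
    (hw : ∀ y, ‖w y‖ ≤ 1) (hf₀ : ∀ x, ‖f₀ x‖ ≤ 1) (hf : ∀ P x, ‖f P x‖ ≤ 1) :
    ‖polyAvg S w f₀ f‖ ≤ 1 := by
  refine norm_expect_le_one fun x => norm_expect_le_one fun y => ?_
  rw [norm_mul, norm_mul]
  exact mul_le_one₀ (hf₀ _) (by positivity)
    (mul_le_one₀ (hw _) (norm_nonneg _) (norm_prod_le_one fun P => hf _ _))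

/-- The members of `S` are determined by their slopes, and `f₀` joins them as the function of slope
zero, indexed by the polynomial 0. There are thus `S.card + 1` functions. -/
lemma polyAvg_linear_bound {S : Finset F[X]} (hS : ∀ P ∈ S, P ≠ 0 ∧ P.coeff 0 = 0)
    (hdeg : ∀ P ∈ S, P.natDegree ≤ 1) {Q : F[X]} (hQ : Q ∈ S) {w f₀ : F → ℂ} {f : F[X] → F → ℂ}
    (hw : ∀ y, ‖w y‖ ≤ 1) (hf₀ : ∀ x, ‖f₀ x‖ ≤ 1) (hf : ∀ P x, ‖f P x‖ ≤ 1) :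
    ‖polyAvg S w f₀ f‖ ^ (2 ^ (S.card + 1)) ≤ gowersPow S.card (f Q) := by
  classical
  have hform : ∀ P ∈ insert 0 S, P = C (P.coeff 1) * X := by
    intro P hP
    rcases mem_insert.1 hP with rfl | hP
    · simp
    · conv_lhs => rw [Polynomial.eq_X_add_C_of_natDegree_le_one (hdeg P hP), (hS P hP).2]
      simp
  have h0 : (0 : F[X]) ∉ S := fun h => (hS 0 h).1 rfl
  have key := linear_family_bound S.card (insert 0 S) (card_insert_of_notMem h0)
    (fun P : F[X] => P.coeff 1) (fun P hP P' hP' h => by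
      rw [hform P hP, hform P' hP']; simp only at h; rw [h]) (mem_insert_of_mem hQ) hw
    (f := fun P => if P = 0 then f₀ else f P) (fun P x => by
      by_cases hP : P = 0
      · simpa [hP] using hf₀ x
      · simpa [hP] using hf P x)
  have hQ0 : Q ≠ 0 := (hS Q hQ).1
  simp only [hQ0, if_false] at key
  refine le_trans (le_of_eq ?_) key
  congr 2
  refine expect_congr rfl fun x _ => expect_congr rfl fun y _ => ?_
  rw [prod_insert h0]
  simp only [if_true, coeff_zero, zero_mul, add_zero]
  rw [mul_left_comm]
  congr 2
  refine prod_congr rfl fun P hP => ?_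
  rw [if_neg (hS P hP).1]
  have : P.eval y = P.coeff 1 * y := by
    conv_lhs => rw [hform P (mem_insert_of_mem hP)]
    simp
  rw [this]

/-- The translate `P(y + h) - P(h)`. -/
noncomputable def shift (h : F) (P : F[X]) : F[X] := taylor h P - C (P.eval h)

lemma eval_shift (h y : F) (P : F[X]) : (shift h P).eval y = P.eval (y + h) - P.eval h := by
  simp [shift, taylor_eval]

lemma coeff_zero_shift (h : F) (P : F[X]) : (shift h P).coeff 0 = 0 := by
  simp [shift, taylor_coeff_zero]

lemma coeff_shift (h : F) (P : F[X]) {k : ℕ} (hk : k ≠ 0) :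
    (shift h P).coeff k = (taylor h P).coeff k := by
  simp [shift, coeff_C, hk]

lemma natDegree_shift (h : F) (P : F[X]) : (shift h P).natDegree = P.natDegree := by
  rw [shift, natDegree_sub_C, natDegree_taylor]

lemma shift_injOn (h : F) {P P' : F[X]} (hP : P.coeff 0 = 0) (hP' : P'.coeff 0 = 0)
    (he : shift h P = shift h P') : P = P' := by
  have h1 : taylor h P = taylor h (P' + C (P.eval h - P'.eval h)) := by
    rw [map_add, taylor_C, C_sub]
    rw [shift, shift] at he
    linear_combination he
  have h2 := taylor_injective h h1
  have h3 := congrArg (fun R => R.coeff 0) h2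
  simp only [coeff_add, coeff_C_zero, hP, hP', zero_add] at h3
  rw [h2, ← h3]; simp

lemma shift_zero {P : F[X]} (hP : P.coeff 0 = 0) : shift 0 P = P := by
  simp [shift, ← coeff_zero_eq_eval_zero, hP]

open Classical in
/-- The family obtained from `S` by an application of the van der Corput inequality. -/
noncomputable def vdcFamily (S : Finset F[X]) (P₁ : F[X]) (h : F) : Finset F[X] :=
  (S.image (fun P => shift h P - P₁) ∪ S.image (fun P => P - P₁)).erase 0

lemma card_vdcFamily_le (S : Finset F[X]) (P₁ : F[X]) (h : F) :
    (vdcFamily S P₁ h).card ≤ 2 * S.card := by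
  classical
  refine (card_le_card (erase_subset _ _)).trans ((card_union_le _ _).trans ?_)
  rw [two_mul]
  exact add_le_add card_image_le card_image_le

lemma mem_vdcFamily {S : Finset F[X]} {P₁ R : F[X]} {h : F} : R ∈ vdcFamily S P₁ h ↔
    R ≠ 0 ∧ ∃ P ∈ S, R = shift h P - P₁ ∨ R = P - P₁ := by
  classical
  simp only [vdcFamily, mem_erase, mem_union, mem_image]
  grind

/-- Translating x by -P₁(y) after differencing produces the new family. Functions that land on the
same polynomial are multiplied together, and those landing on 0 form `f₀'`. If `shift h Q ∉ S`,
nothing collides with the shifted `Q`, whose function is then a mere translate of `f Q` and has the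
same Gowers norms. -/
lemma exists_vdcFamily_eq {S : Finset F[X]} {P₁ : F[X]} (hP₁ : P₁ ∈ S)
    (hS : ∀ P ∈ S, P.coeff 0 = 0) {w : F → ℂ} {f : F[X] → F → ℂ} (hw : ∀ y, ‖w y‖ ≤ 1)
    (hf : ∀ P x, ‖f P x‖ ≤ 1) (h : F) :
    ∃ (w' f₀' : F → ℂ) (f' : F[X] → F → ℂ), (∀ y, ‖w' y‖ ≤ 1) ∧ (∀ x, ‖f₀' x‖ ≤ 1) ∧
      (∀ P x, ‖f' P x‖ ≤ 1) ∧
      (𝔼 x, 𝔼 y, (w (y + h) * ∏ P ∈ S, f P (x + P.eval (y + h))) *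
        conj (w y * ∏ P ∈ S, f P (x + P.eval y))) = polyAvg (vdcFamily S P₁ h) w' f₀' f' ∧
      ∀ Q ∈ S, shift h Q ∉ S → f' (shift h Q - P₁) = fun x => f Q (x + Q.eval h) := by
  classical
  set f' : F[X] → F → ℂ := fun R x => (∏ P ∈ S with shift h P - P₁ = R, f P (x + P.eval h)) *
    ∏ P ∈ S with P - P₁ = R, conj (f P x) with hf'
  have hf'1 : ∀ P x, ‖f' P x‖ ≤ 1 := by
    intro P x
    rw [hf', norm_mul]
    exact mul_le_one₀ (norm_prod_le_one fun P => hf _ _) (norm_nonneg _)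
      (norm_prod_le_one fun P => by rw [RCLike.norm_conj]; exact hf _ _)
  refine ⟨fun y => w (y + h) * conj (w y), f' 0, f', fun y => norm_mul_conj_le_one (hw _) (hw _),
    hf'1 0, hf'1, ?_, ?_⟩
  · rw [polyAvg, expect_comm, expect_comm (s := univ) (t := univ)
      (f := fun x y => f' 0 x * ((w (y + h) * conj (w y)) *
        ∏ P ∈ vdcFamily S P₁ h, f' P (x + P.eval y)))]
    refine expect_congr rfl fun y _ => ?_
    rw [← expect_add_right (fun x => (w (y + h) * ∏ P ∈ S, f P (x + P.eval (y + h))) *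
        conj (w y * ∏ P ∈ S, f P (x + P.eval y))) (- P₁.eval y)]
    refine expect_congr rfl fun x _ => ?_
    set S' := S.image (fun P => shift h P - P₁) ∪ S.image (fun P => P - P₁) with hS'
    have h0 : (0 : F[X]) ∈ S' := mem_union_right _ (mem_image.2 ⟨P₁, hP₁, sub_self _⟩)
    have hprod : f' 0 x * ∏ P ∈ vdcFamily S P₁ h, f' P (x + P.eval y) =
        ∏ R ∈ S', f' R (x + R.eval y) := by
      rw [← mul_prod_erase S' _ h0, vdcFamily, eval_zero, add_zero]
    have h1 : ∏ R ∈ S', ∏ P ∈ S with shift h P - P₁ = R, f P (x + R.eval y + P.eval h) =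
        ∏ P ∈ S, f P (x + - P₁.eval y + P.eval (y + h)) := by
      rw [← prod_fiberwise_of_maps_to (t := S') (g := fun P => shift h P - P₁)
        (fun P hP => mem_union_left _ (mem_image_of_mem _ hP))]
      refine prod_congr rfl fun R _ => prod_congr rfl fun P hP => ?_
      rw [← (mem_filter.1 hP).2, eval_sub, eval_shift]
      congr 1; ring
    have h2 : ∏ R ∈ S', ∏ P ∈ S with P - P₁ = R, conj (f P (x + R.eval y)) =
        ∏ P ∈ S, conj (f P (x + - P₁.eval y + P.eval y)) := by
      rw [← prod_fiberwise_of_maps_to (t := S') (g := fun P => P - P₁)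
        (fun P hP => mem_union_right _ (mem_image_of_mem _ hP))]
      refine prod_congr rfl fun R _ => prod_congr rfl fun P hP => ?_
      rw [← (mem_filter.1 hP).2, eval_sub]
      congr 2; ring
    rw [mul_left_comm, hprod, hf', prod_mul_distrib, h1, h2, map_mul, map_prod]
    ring
  · intro Q hQ hQS
    ext x
    have h1 : (S.filter fun P => shift h P - P₁ = shift h Q - P₁) = {Q} := by
      ext P
      simp only [mem_filter, mem_singleton]
      constructor
      · rintro ⟨hP, he⟩
        exact shift_injOn h (hS P hP) (hS Q hQ) (sub_left_injective he)
      · rintro rfl; exact ⟨hQ, rfl⟩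
    have h2 : (S.filter fun P => P - P₁ = shift h Q - P₁) = ∅ := by
      refine filter_eq_empty_iff.2 fun P hP he => hQS ?_
      rw [← sub_left_injective he]; exact hP
    simp only [hf', h1, h2, prod_singleton, prod_empty, mul_one]

end Families

/-! ### The PET step: lowering the type of a family -/

section PET

set_option linter.unusedSectionVars false

variable {F : Type u} [Field F] [Fintype F]

lemma natCast_ne_zero_of_lt_ringChar {n : ℕ} (hn : n ≠ 0) (h : n < ringChar F) : (n : F) ≠ 0 := by
  rw [Ne, ringChar.spec]
  exact fun hd => absurd (Nat.le_of_dvd (Nat.pos_of_ne_zero hn) hd) (not_le.2 h)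

lemma coeff_taylor_of_natDegree_le (h : F) (P : F[X]) {n : ℕ} (hP : P.natDegree ≤ n + 1) :
    (taylor h P).coeff n = P.coeff n + (n + 1 : ℕ) * P.coeff (n + 1) * h := by
  have hd : (hasseDeriv n P).natDegree < 2 := by
    have := natDegree_hasseDeriv_le P n
    omega
  rw [taylor_coeff, eval_eq_sum_range' hd, sum_range_succ, sum_range_one]
  simp only [hasseDeriv_coeff]
  simp [add_comm 1 n]

lemma coeff_taylor_of_natDegree_le' (h : F) (P : F[X]) {n : ℕ} (hP : P.natDegree ≤ n) :
    (taylor h P).coeff n = P.coeff n := by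
  rcases hP.lt_or_eq with hP | rfl
  · rw [coeff_eq_zero_of_natDegree_lt hP, coeff_eq_zero_of_natDegree_lt]
    rwa [natDegree_taylor]
  · rw [coeff_taylor_natDegree, leadingCoeff]

open Classical in
/-- The leading coefficients of the members of `S` of degree `k`. -/
noncomputable def leadCoeffs (S : Finset F[X]) (k : ℕ) : Finset F :=
  (S.filter fun P => P.natDegree = k).image fun P => P.coeff k

lemma card_leadCoeffs_le (S : Finset F[X]) (k : ℕ) : (leadCoeffs S k).card ≤ S.card := by
  classical
  exact card_image_le.trans (card_filter_le _ _)

open Classical in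
-- The coefficient of `shift h Q` just below the top is an affine function of `h` with nonzero
-- slope, so distinct `h` give distinct shifts. These are the exceptional `h` of the PET step.
lemma card_filter_shift_mem_le {S : Finset F[X]} {Q : F[X]} {n : ℕ} (hn : n ≠ 0)
    (hQ : Q.natDegree = n + 1) (hp : n + 1 < ringChar F) :
    (univ.filter fun h : F => shift h Q ∈ S).card ≤ S.card := by
  refine card_le_card_of_injOn (fun h => shift h Q) (fun h hh => (mem_filter.1 hh).2) ?_
  intro h _ h' _ he
  have h1 := congrArg (fun R => R.coeff n) he
  simp only [coeff_shift _ _ hn, coeff_taylor_of_natDegree_le _ Q hQ.le] at h1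
  have h2 : ((n + 1 : ℕ) : F) ≠ 0 := natCast_ne_zero_of_lt_ringChar (by omega) hp
  have h3 : Q.coeff (n + 1) ≠ 0 := by
    rw [← hQ, coeff_natDegree, leadingCoeff_ne_zero]
    rintro rfl; simp at hQ
  exact mul_left_cancel₀ (mul_ne_zero h2 h3) (add_left_cancel h1)

/-- The step of the PET induction: a suitable application of the van der Corput inequality lowers
the type of the family and keeps the distinguished polynomial of maximal degree. -/
lemma exists_pet_step {S : Finset F[X]} {Q : F[X]} (hQ : Q ∈ S) {D : ℕ} (hD : Q.natDegree = D + 1)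
    (hD0 : D ≠ 0) (hp : D + 1 < ringChar F)
    (hS : ∀ P ∈ S, P ≠ 0 ∧ P.coeff 0 = 0 ∧ P.natDegree ≤ Q.natDegree) :
    ∃ j ≤ D + 1, ∃ P₁ ∈ S, leadCoeffs S j ≠ ∅ ∧ ∀ h, shift h Q ∉ S →
      shift h Q - P₁ ∈ vdcFamily S P₁ h ∧ (shift h Q - P₁).natDegree ≤ D + 1 ∧
      (∀ R ∈ vdcFamily S P₁ h, R ≠ 0 ∧ R.coeff 0 = 0 ∧
        R.natDegree ≤ (shift h Q - P₁).natDegree) ∧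
      (∀ k, j < k → (leadCoeffs (vdcFamily S P₁ h) k).card ≤ (leadCoeffs S k).card) ∧
      (leadCoeffs (vdcFamily S P₁ h) j).card ≤ (leadCoeffs S j).card - 1 := by
  classical
  have hQlc : Q.coeff (D + 1) ≠ 0 := by
    rw [← hD, coeff_natDegree, leadingCoeff_ne_zero]; exact (hS Q hQ).1
  have hsh : ∀ h P k, k ≠ 0 → P ∈ S → P.natDegree ≤ k → (shift h P).coeff k = P.coeff k :=
    fun h P k hk hP hPk => by rw [coeff_shift _ _ hk, coeff_taylor_of_natDegree_le' _ _ hPk]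
  -- the choice of `P₁`
  have hchoice : ∃ P₁ ∈ S, (∀ P ∈ S, P₁.natDegree ≤ P.natDegree) ∧
      (P₁.coeff (D + 1) ≠ Q.coeff (D + 1) ∨
        (P₁ = Q ∧ ∀ P ∈ S, P.coeff (D + 1) = Q.coeff (D + 1))) := by
    have hdegeq : ∀ P ∈ S, P.coeff (D + 1) = Q.coeff (D + 1) → P.natDegree = D + 1 := by
      intro P hP he
      refine le_antisymm (hD ▸ (hS P hP).2.2) (le_natDegree_of_ne_zero ?_)
      rw [he]; exact hQlc
    by_cases hex : ∃ P ∈ S, P.coeff (D + 1) ≠ Q.coeff (D + 1)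
    · obtain ⟨P₁, hP₁, hmin⟩ := exists_min_image
        (S.filter fun P => P.coeff (D + 1) ≠ Q.coeff (D + 1)) natDegree
        (by obtain ⟨P, hP, hPQ⟩ := hex; exact ⟨P, mem_filter.2 ⟨hP, hPQ⟩⟩)
      rw [mem_filter] at hP₁
      refine ⟨P₁, hP₁.1, fun P hP => ?_, Or.inl hP₁.2⟩
      by_cases hPQ : P.coeff (D + 1) = Q.coeff (D + 1)
      · rw [hdegeq P hP hPQ, ← hD]; exact (hS _ hP₁.1).2.2
      · exact hmin P (mem_filter.2 ⟨hP, hPQ⟩)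
    · push Not at hex
      refine ⟨Q, hQ, fun P hP => ?_, Or.inr ⟨rfl, hex⟩⟩
      rw [hdegeq P hP (hex P hP), hD]
  obtain ⟨P₁, hP₁, hmin, hcase⟩ := hchoice
  have hj0 : P₁.natDegree ≠ 0 := by
    intro h
    have h1 := eq_C_of_natDegree_eq_zero h
    rw [(hS _ hP₁).2.1, C_0] at h1
    exact (hS _ hP₁).1 h1
  have hjlc : P₁.coeff P₁.natDegree ∈ leadCoeffs S P₁.natDegree :=
    mem_image.2 ⟨P₁, mem_filter.2 ⟨hP₁, rfl⟩, rfl⟩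
  refine ⟨P₁.natDegree, hD ▸ (hS _ hP₁).2.2, P₁, hP₁, ne_empty_of_mem hjlc, fun h hh => ?_⟩
  have hmem : shift h Q - P₁ ∈ vdcFamily S P₁ h := by
    refine mem_vdcFamily.2 ⟨fun h0 => hh ?_, Q, hQ, Or.inl rfl⟩
    rw [sub_eq_zero.1 h0]; exact hP₁
  -- members of the new family are `P' - P₁` with `P'` similar to some member of `S`
  have hR : ∀ R ∈ vdcFamily S P₁ h, R ≠ 0 ∧ ∃ P ∈ S, ∃ P' : F[X], R = P' - P₁ ∧
      P'.natDegree = P.natDegree ∧ P'.coeff 0 = 0 ∧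
      ∀ k, k ≠ 0 → P.natDegree ≤ k → P'.coeff k = P.coeff k := by
    intro R hR
    obtain ⟨h0, P, hP, rfl | rfl⟩ := mem_vdcFamily.1 hR
    · exact ⟨h0, P, hP, _, rfl, natDegree_shift _ _, coeff_zero_shift _ _,
        fun k hk hPk => hsh h P k hk hP hPk⟩
    · exact ⟨h0, P, hP, _, rfl, rfl, (hS P hP).2.1, fun _ _ _ => rfl⟩
  have hRdeg : ∀ R ∈ vdcFamily S P₁ h, R.natDegree ≤ D + 1 := by
    intro R hRm
    obtain ⟨-, P, hP, P', rfl, hd, -⟩ := hR R hRm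
    refine (natDegree_sub_le _ _).trans (max_le ?_ ?_)
    · rw [hd, ← hD]; exact (hS P hP).2.2
    · rw [← hD]; exact (hS _ hP₁).2.2
  refine ⟨hmem, hRdeg _ hmem, fun R hRm => ⟨(hR R hRm).1, ?_, ?_⟩, fun k hk => ?_, ?_⟩
  · obtain ⟨-, P, hP, P', rfl, -, h0, -⟩ := hR R hRm
    rw [coeff_sub, h0, (hS _ hP₁).2.1, sub_zero]
  -- If the top coefficients differ, the difference keeps degree D + 1. If they all agree, degree D
  -- + 1 leaves the whole family, and the shifted `Q` keeps a coefficient proportional to `h` in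
  -- degree D; here h ≠ 0 because `shift 0 Q = Q` lies in `S`.
  · rcases hcase with hne | ⟨rfl, hall⟩
    · refine (hRdeg R hRm).trans (le_natDegree_of_ne_zero ?_)
      rw [coeff_sub, hsh h Q _ (by omega) hQ hD.le]
      exact sub_ne_zero.2 hne.symm
    · have h1 : R.natDegree ≤ D := by
        refine natDegree_le_iff_coeff_eq_zero.2 fun N hN => ?_
        rcases (Nat.succ_le_of_lt hN).lt_or_eq with hN | rfl
        · exact coeff_eq_zero_of_natDegree_lt ((hRdeg R hRm).trans_lt hN)
        · obtain ⟨-, P, hP, P', rfl, -, -, hc⟩ := hR R hRm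
          rw [Nat.succ_eq_add_one, coeff_sub, hc _ (by omega) (hD ▸ (hS P hP).2.2), hall P hP,
            sub_self]
      refine h1.trans (le_natDegree_of_ne_zero ?_)
      rw [coeff_sub, coeff_shift _ _ hD0, coeff_taylor_of_natDegree_le _ _ hD.le,
        add_sub_cancel_left]
      refine mul_ne_zero (mul_ne_zero (natCast_ne_zero_of_lt_ringChar (by omega) hp) hQlc) ?_
      rintro rfl
      rw [shift_zero (hS _ hQ).2.1] at hh
      exact hh hQ
  · refine card_le_card fun c hc => ?_
    obtain ⟨R, hRm, rfl⟩ := mem_image.1 hc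
    obtain ⟨hRm, hRk⟩ := mem_filter.1 hRm
    obtain ⟨-, P, hP, P', rfl, hd, -, hc'⟩ := hR R hRm
    have h1 : P'.natDegree = k := by
      refine le_antisymm ?_ ?_
      · have : P' = (P' - P₁) + P₁ := by ring
        rw [this]
        exact (natDegree_add_le _ _).trans (max_le hRk.le hk.le)
      · rw [← hRk]
        by_contra hlt
        push Not at hlt
        have := natDegree_sub_le P' P₁
        rcases le_max_iff.1 this with h2 | h2 <;> omega
    refine mem_image.2 ⟨P, mem_filter.2 ⟨hP, by rw [← hd, h1]⟩, ?_⟩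
    rw [coeff_sub, hc' k (by omega) (by omega), coeff_eq_zero_of_natDegree_lt hk, sub_zero]
  -- As P₁ has minimal degree, new members of its degree come from old ones of that degree. Their
  -- leading coefficients are old ones minus that of P₁, and the value 0 cannot occur, so one
  -- coefficient is lost.
  · rw [← card_erase_of_mem hjlc]
    refine (card_le_card fun c hc => ?_).trans
      (card_image_le (f := fun c => c - P₁.coeff P₁.natDegree))
    obtain ⟨R, hRm, rfl⟩ := mem_image.1 hc
    obtain ⟨hRm, hRk⟩ := mem_filter.1 hRm
    obtain ⟨h0, P, hP, P', hRP, hd, -, hc'⟩ := hR R hRm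
    have h1 : P.natDegree = P₁.natDegree := by
      refine le_antisymm ?_ (hmin P hP)
      have : P' = R + P₁ := by rw [hRP]; ring
      rw [← hd, this]
      exact (natDegree_add_le _ _).trans (max_le hRk.le le_rfl)
    have h2 : R.coeff P₁.natDegree = P.coeff P₁.natDegree - P₁.coeff P₁.natDegree := by
      rw [hRP, coeff_sub, hc' _ hj0 h1.le]
    refine mem_image.2 ⟨P.coeff P₁.natDegree, mem_erase.2 ⟨fun he => h0 ?_,
      mem_image.2 ⟨P, mem_filter.2 ⟨hP, h1⟩, rfl⟩⟩, h2.symm⟩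
    rw [← leadingCoeff_eq_zero, leadingCoeff, hRk, h2, he, sub_self]

end PET

/-! ### PET induction: control by Gowers norms -/

section PETInduction

/-- A polynomial bound for `a` in terms of the `n`-th term of `U`, up to an error `1 / q`. -/
def Dominated (n : ℕ) (a : ℝ) (U : ℕ → ℝ) (q : ℝ) : Prop :=
  a ^ (2 ^ (2 * n)) ≤ 2 ^ (3 ^ n) * (U n + 1 / q)

/-- The constants in `Dominated` absorb a doubling followed by a squaring, because 3 + 2·3^n ≤
3^(n+1) for n ≥ 1. -/
lemma sq_two_mul_le {n : ℕ} {U : ℕ → ℝ} {q : ℝ} (hU : ∀ n, U n ^ 2 ≤ U (n + 1)) (hq : 1 ≤ q)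
    (hn : n ≠ 0) : (2 * 2 ^ (3 ^ n) * (U n + 1 / q)) ^ 2 ≤
      2 ^ (3 ^ (n + 1)) * (U (n + 1) + 1 / q) := by
  have h1 : (1 / q) ^ 2 ≤ 1 / q := by
    have h0 : 0 ≤ 1 / q := by positivity
    have : 1 / q ≤ 1 := by rw [div_le_one (by linarith)]; exact hq
    nlinarith
  have h2 : (U n + 1 / q) ^ 2 ≤ 2 * (U (n + 1) + 1 / q) := by
    nlinarith [hU n, sq_nonneg (U n - 1 / q)]
  have h4 : 0 ≤ U (n + 1) + 1 / q := by
    have := (sq_nonneg (U n)).trans (hU n)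
    positivity
  have h3 : (8 : ℝ) * (2 ^ (3 ^ n)) ^ 2 ≤ 2 ^ (3 ^ (n + 1)) := by
    have : (8 : ℝ) = 2 ^ 3 := by norm_num
    rw [this, ← pow_mul, ← pow_add]
    refine pow_le_pow_right₀ (by norm_num) ?_
    have : 3 ^ 1 ≤ 3 ^ n := Nat.pow_le_pow_right (by norm_num) (Nat.pos_of_ne_zero hn)
    rw [pow_succ]; omega
  calc _ = 4 * (2 ^ (3 ^ n)) ^ 2 * (U n + 1 / q) ^ 2 := by ring
    _ ≤ 4 * (2 ^ (3 ^ n)) ^ 2 * (2 * (U (n + 1) + 1 / q)) := by gcongr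
    _ = 8 * (2 ^ (3 ^ n)) ^ 2 * (U (n + 1) + 1 / q) := by ring
    _ ≤ _ := by gcongr

lemma Dominated.succ {n : ℕ} {a : ℝ} {U : ℕ → ℝ} {q : ℝ} (ha : 0 ≤ a) (ha1 : a ≤ 1)
    (hU0 : ∀ n, 0 ≤ U n) (hU : ∀ n, U n ^ 2 ≤ U (n + 1)) (hq : 1 ≤ q) (hn : n ≠ 0)
    (h : Dominated n a U q) : Dominated (n + 1) a U q := by
  have h1 : a ^ (2 ^ (2 * (n + 1))) ≤ (a ^ (2 ^ (2 * n))) ^ 2 := by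
    rw [← pow_mul, ← pow_succ]
    exact pow_le_pow_of_le_one ha ha1 (Nat.pow_le_pow_right (by norm_num) (by omega))
  refine (h1.trans (pow_le_pow_left₀ (by positivity) (h.trans ?_) 2)).trans (sq_two_mul_le hU hq hn)
  have := hU0 n
  have h3 : 0 ≤ 2 ^ (3 ^ n) * (U n + 1 / q) := by positivity
  linarith

lemma Dominated.mono {n m : ℕ} {a : ℝ} {U : ℕ → ℝ} {q : ℝ} (ha : 0 ≤ a) (ha1 : a ≤ 1)
    (hU0 : ∀ n, 0 ≤ U n) (hU : ∀ n, U n ^ 2 ≤ U (n + 1)) (hq : 1 ≤ q) (hn : n ≠ 0) (hnm : n ≤ m)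
    (h : Dominated n a U q) : Dominated m a U q := by
  induction m, hnm using Nat.le_induction with
  | base => exact h
  | succ m hm ih => exact ih.succ ha ha1 hU0 hU hq (by omega)

lemma one_le_card_field (F : Type u) [Field F] [Fintype F] : (1 : ℝ) ≤ Fintype.card F := by
  exact_mod_cast Fintype.card_pos

/-- Control of all polynomial averages of type `t` with at most `K` polynomials of degree at most
`d` by a Gowers norm of the function attached to a polynomial of maximal degree. -/
def PETBound (d K : ℕ) (t : Fin (d + 1) → ℕ) (n : ℕ) : Prop :=
  ∀ (F : Type u) [Field F] [Fintype F], d < ringChar F → ∀ (S : Finset F[X]) (Q : F[X]), Q ∈ S →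
    (∀ P ∈ S, P ≠ 0 ∧ P.coeff 0 = 0 ∧ P.natDegree ≤ Q.natDegree) → Q.natDegree ≤ d →
    S.card ≤ K → (∀ k : Fin (d + 1), (leadCoeffs S k).card ≤ t k) →
    ∀ (w f₀ : F → ℂ) (f : F[X] → F → ℂ), (∀ y, ‖w y‖ ≤ 1) → (∀ x, ‖f₀ x‖ ≤ 1) →
      (∀ P x, ‖f P x‖ ≤ 1) →
      Dominated n ‖polyAvg S w f₀ f‖ (fun k => gowersPow k (f Q)) (Fintype.card F)

/-- After van der Corput, the ordinary shifts have a family of smaller type; the at most `K`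
exceptional ones contribute K/q. Families of degree one are settled by `polyAvg_linear_bound`. The
margin `K + 1 ≤ N` accommodates both their order and the factor K. -/
lemma PETBound.step {d K : ℕ} {t : Fin (d + 1) → ℕ} {N : ℕ} (hK : K + 1 ≤ N)
    (ih : ∀ j, 0 < t j → ∃ n ≤ N, n ≠ 0 ∧ PETBound.{u} d (2 * K)
      (fun k => if j < k then t k else if k = j then t j - 1 else 2 * K) n) :
    PETBound.{u} d K t (N + 1) := by
  classical
  intro F _ _ hd S Q hQ hS hQd hSK ht w f₀ f hw hf₀ hf
  have hq := one_le_card_field F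
  set U : ℕ → ℝ := fun k => gowersPow k (f Q) with hUdef
  have hU0 : ∀ k, 0 ≤ U k := fun k => gowersPow_nonneg _ _
  have hU : ∀ k, U k ^ 2 ≤ U (k + 1) := fun k => gowersPow_sq_le _ _
  have hA1 := norm_polyAvg_le_one S hw hf₀ hf
  rcases Nat.lt_or_ge 1 Q.natDegree with hQ1 | hQ1
  · obtain ⟨D, hD⟩ : ∃ D, Q.natDegree = D + 1 := ⟨Q.natDegree - 1, by omega⟩
    obtain ⟨j, hj, P₁, hP₁, hne, hstep⟩ := exists_pet_step hQ hD (by omega) (by omega) hS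
    let j' : Fin (d + 1) := ⟨j, by omega⟩
    have htj : 0 < t j' := lt_of_lt_of_le (card_pos.2 (nonempty_iff_ne_empty.2 hne)) (ht j')
    obtain ⟨n, hnN, hn0, hn⟩ := ih j' htj
    choose w' f₀' f' hw' hf₀' hf' hrep hdist using fun h : F =>
      exists_vdcFamily_eq hP₁ (fun P hP => (hS P hP).2.1) hw hf h
    have hvdc : ‖polyAvg S w f₀ f‖ ^ 2 ≤
        𝔼 h, ‖polyAvg (vdcFamily S P₁ h) (w' h) (f₀' h) (f' h)‖ := by
      refine (vanDerCorput hf₀ fun x y => w y * ∏ P ∈ S, f P (x + P.eval y)).trans (le_of_eq ?_)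
      exact expect_congr rfl fun h _ => by rw [hrep]
    have hterm : ∀ h, ‖polyAvg (vdcFamily S P₁ h) (w' h) (f₀' h) (f' h)‖ ^ (2 ^ (2 * N)) ≤
        2 ^ (3 ^ N) * (U N + 1 / Fintype.card F) + if shift h Q ∈ S then 1 else 0 := by
      intro h
      have hA0 := norm_nonneg (polyAvg (vdcFamily S P₁ h) (w' h) (f₀' h) (f' h))
      have hA1' := norm_polyAvg_le_one (vdcFamily S P₁ h) (hw' h) (hf₀' h) (hf' h)
      split_ifs with hh
      · have h1 := pow_le_one₀ (n := 2 ^ (2 * N)) hA0 hA1'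
        have := hU0 N
        have : 0 ≤ 2 ^ (3 ^ N) * (U N + 1 / Fintype.card F) := by positivity
        linarith
      · obtain ⟨hm, hdeg, hR, hk, hk'⟩ := hstep h hh
        have h1 := hn F hd (vdcFamily S P₁ h) _ hm hR (hdeg.trans (by omega))
          ((card_vdcFamily_le _ _ _).trans (by omega)) (fun k => by
            dsimp only
            split_ifs with h1 h2
            · exact (hk k h1).trans (ht k)
            · subst h2
              exact hk'.trans (Nat.sub_le_sub_right (ht j') 1)
            · refine (card_leadCoeffs_le _ _).trans
                ((card_vdcFamily_le _ _ _).trans (by omega)))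
          (w' h) (f₀' h) (f' h) (hw' h) (hf₀' h) (hf' h)
        rw [hdist h Q hQ hh] at h1
        simp only [gowersPow_translate] at h1
        rw [add_zero]
        exact h1.mono hA0 hA1' hU0 hU hq hn0 hnN
    have hbad : (𝔼 h : F, if shift h Q ∈ S then (1 : ℝ) else 0) ≤ K * (1 / Fintype.card F) := by
      rw [Fintype.expect_eq_sum_div_card, sum_boole, mul_one_div]
      gcongr
      exact (card_filter_shift_mem_le (by omega) hD (by omega)).trans hSK
    have hC : (K : ℝ) ≤ 2 ^ (3 ^ N) := by
      have h1 : N < 3 ^ N := Nat.lt_pow_self (by norm_num)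
      have h2 : 3 ^ N < 2 ^ (3 ^ N) := Nat.lt_pow_self (by norm_num)
      exact_mod_cast (by omega : K ≤ 2 ^ (3 ^ N))
    have hsq : (‖polyAvg S w f₀ f‖ ^ 2) ^ (2 ^ (2 * N)) ≤
        2 * 2 ^ (3 ^ N) * (U N + 1 / Fintype.card F) := by
      calc _ ≤ (𝔼 h, ‖polyAvg (vdcFamily S P₁ h) (w' h) (f₀' h) (f' h)‖) ^ (2 ^ (2 * N)) := by
            gcongr
        _ ≤ 𝔼 h, ‖polyAvg (vdcFamily S P₁ h) (w' h) (f₀' h) (f' h)‖ ^ (2 ^ (2 * N)) :=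
            expect_pow_le (fun _ => norm_nonneg _) _ (by positivity)
        _ ≤ 𝔼 h : F, (2 ^ (3 ^ N) * (U N + 1 / Fintype.card F) +
              if shift h Q ∈ S then 1 else 0) := expect_le_expect fun h _ => hterm h
        _ ≤ 2 ^ (3 ^ N) * (U N + 1 / Fintype.card F) + K * (1 / Fintype.card F) := by
            rw [expect_add_distrib, Fintype.expect_const]
            gcongr
        _ ≤ 2 ^ (3 ^ N) * (U N + 1 / Fintype.card F) +
              2 ^ (3 ^ N) * (U N + 1 / Fintype.card F) := by
            gcongr
            linarith [hU0 N]
        _ = _ := by ring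
    -- Van der Corput and `sq_two_mul_le` each contribute one squaring, hence the exponent
    -- 2^(2(N+1)).
    refine le_trans (le_of_eq ?_) ((pow_le_pow_left₀ (by positivity) hsq 2).trans
      (sq_two_mul_le hU hq (by omega)))
    rw [← pow_mul, ← pow_mul]
    congr 1
    rw [show 2 * (N + 1) = 2 * N + 1 + 1 by ring, pow_succ, pow_succ]; ring
  · have h1 := polyAvg_linear_bound (fun P hP => ⟨(hS P hP).1, (hS P hP).2.1⟩)
      (fun P hP => (hS P hP).2.2.trans hQ1) hQ hw hf₀ hf
    have hc : 1 ≤ S.card := card_pos.2 ⟨Q, hQ⟩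
    have h2 : Dominated S.card ‖polyAvg S w f₀ f‖ U (Fintype.card F) := by
      refine (pow_le_pow_of_le_one (norm_nonneg _) hA1
        (Nat.pow_le_pow_right (by norm_num) (by omega : S.card + 1 ≤ 2 * S.card))).trans
        (h1.trans ?_)
      have h3 : (1 : ℝ) ≤ 2 ^ (3 ^ S.card) := one_le_pow₀ (by norm_num)
      have h4 : (0 : ℝ) ≤ 1 / Fintype.card F := by positivity
      have h5 := hU0 S.card
      calc U S.card ≤ 1 * (U S.card + 1 / Fintype.card F) := by linarith
        _ ≤ _ := by gcongr
    exact h2.mono (norm_nonneg _) hA1 hU0 hU hq (by omega) (by omega)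

lemma exists_petBound_of_type (d : ℕ) (t : Fin (d + 1) → ℕ) :
    ∀ K, ∃ n, n ≠ 0 ∧ PETBound.{u} d K t n := by
  -- Types are compared lexicographically from the highest degree down, so that entries in lower
  -- degrees may grow.
  have hwf : WellFounded (Pi.Lex (· > ·) fun {_ : Fin (d + 1)} => ((· < ·) : ℕ → ℕ → Prop)) :=
    Pi.Lex.wellFounded _ fun _ => wellFounded_lt
  induction t using hwf.induction with
  | _ t ih =>
    intro K
    have h : ∀ j, ∃ n, 0 < t j → n ≠ 0 ∧ PETBound.{u} d (2 * K)
        (fun k => if j < k then t k else if k = j then t j - 1 else 2 * K) n := by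
      intro j
      by_cases hj : 0 < t j
      · obtain ⟨n, hn⟩ := ih (fun k => if j < k then t k else if k = j then t j - 1 else 2 * K)
          ⟨j, fun k hk => if_pos hk, by simp; omega⟩ (2 * K)
        exact ⟨n, fun _ => hn⟩
      · exact ⟨0, fun h => absurd h hj⟩
    choose n hn using h
    refine ⟨univ.sup n + K + 1 + 1, by omega, PETBound.step (by omega) fun j hj =>
      ⟨n j, ?_, (hn j hj).1, (hn j hj).2⟩⟩
    have := le_sup (f := n) (mem_univ j)
    omega

theorem exists_petBound (d K : ℕ) : ∃ n, ∀ (F : Type u) [Field F] [Fintype F], d < ringChar F →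
    ∀ (S : Finset F[X]) (Q : F[X]), Q ∈ S →
    (∀ P ∈ S, P ≠ 0 ∧ P.coeff 0 = 0 ∧ P.natDegree ≤ Q.natDegree) → Q.natDegree ≤ d →
    S.card ≤ K → ∀ (w f₀ : F → ℂ) (f : F[X] → F → ℂ), (∀ y, ‖w y‖ ≤ 1) → (∀ x, ‖f₀ x‖ ≤ 1) →
      (∀ P x, ‖f P x‖ ≤ 1) →
      n ≠ 0 ∧ Dominated n ‖polyAvg S w f₀ f‖ (fun k => gowersPow k (f Q)) (Fintype.card F) := by
  obtain ⟨n, hn0, hn⟩ := exists_petBound_of_type.{u} d (fun _ => K) K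
  refine ⟨n, fun F _ _ hd S Q hQ hS hQd hSK w f₀ f hw hf₀ hf => ⟨hn0, ?_⟩⟩
  exact hn F hd S Q hQ hS hQd hSK
    (fun k => (card_leadCoeffs_le _ _).trans hSK) w f₀ f hw hf₀ hf

end PETInduction

/-! ### Weyl's bound and dual functions -/

section Dual

set_option linter.unusedSectionVars false

variable {F : Type u} [Field F] [Fintype F] {e : AddChar F ℂ}

/-- Weyl's bound for exponential sums. -/
lemma weyl_bound (he : e ≠ 1) (n : ℕ) {Q : F[X]} (hQ : Q.natDegree = n + 1)
    (hp : n + 1 < ringChar F) :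
    ‖𝔼 y, e (Q.eval y)‖ ^ (2 ^ n) ≤ n / Fintype.card F := by
  classical
  induction n generalizing Q with
  | zero =>
    have hQ1 : Q.coeff 1 ≠ 0 := by
      rw [show 1 = Q.natDegree by rw [hQ], coeff_natDegree, leadingCoeff_ne_zero]
      rintro rfl; simp at hQ
    have h1 : ∀ y, e (Q.eval y) = e (y * Q.coeff 1) * e (Q.coeff 0) := by
      intro y
      rw [← AddChar.map_add_eq_mul]
      congr 1
      conv_lhs => rw [eq_X_add_C_of_natDegree_le_one hQ.le]
      simp; ring
    simp only [h1, ← expect_mul, Fintype.expect_eq_sum_div_card, sum_char_mul he, if_neg hQ1]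
    simp
  | succ n ih =>
    have h1 : ‖𝔼 y, e (Q.eval y)‖ ^ 2 ≤ 𝔼 h, ‖𝔼 y, e ((taylor h Q - Q).eval y)‖ := by
      have := vanDerCorput (f₀ := fun _ : F => (1 : ℂ)) (fun _ => by simp)
        (fun _ y => e (Q.eval y))
      simpa only [one_mul, Fintype.expect_const, char_mul_conj, eval_sub, taylor_eval] using this
    rw [pow_succ' 2 n, pow_mul]
    calc _ ≤ (𝔼 h, ‖𝔼 y, e ((taylor h Q - Q).eval y)‖) ^ (2 ^ n) := by gcongr
      _ ≤ 𝔼 h, ‖𝔼 y, e ((taylor h Q - Q).eval y)‖ ^ (2 ^ n) :=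
          expect_pow_le (fun _ => norm_nonneg _) _ (by positivity)
      -- The shift h = 0 costs 1/q at each differencing, while the linear case costs nothing; this
      -- gives the numerator.
      _ ≤ 𝔼 h : F, ((n : ℝ) / Fintype.card F + if h = 0 then 1 else 0) := by
          refine expect_le_expect fun h _ => ?_
          split_ifs with h0
          · have h2 : ‖𝔼 y, e ((taylor h Q - Q).eval y)‖ ≤ 1 :=
              norm_expect_le_one fun y => by rw [AddChar.norm_apply]
            have h3 := pow_le_one₀ (n := 2 ^ n) (norm_nonneg _) h2
            have : (0 : ℝ) ≤ n / Fintype.card F := by positivity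
            linarith
          · rw [add_zero]
            refine ih ?_ (by omega)
            have hlc : Q.coeff (n + 1 + 1) ≠ 0 := by
              rw [← hQ, coeff_natDegree, leadingCoeff_ne_zero]
              rintro rfl; simp at hQ
            refine le_antisymm (natDegree_le_iff_coeff_eq_zero.2 fun N hN => ?_)
              (le_natDegree_of_ne_zero ?_)
            · rw [coeff_sub, coeff_taylor_of_natDegree_le' _ _ (by omega), sub_self]
            · rw [coeff_sub, coeff_taylor_of_natDegree_le _ _ hQ.le, add_sub_cancel_left]
              exact mul_ne_zero (mul_ne_zero (natCast_ne_zero_of_lt_ringChar (by omega) hp) hlc) h0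
      _ = _ := by
          rw [expect_add_distrib, Fintype.expect_const, Fintype.expect_eq_sum_div_card,
            sum_ite_eq' univ (0 : F), if_pos (mem_univ _)]
          push_cast; ring

open Classical in
/-- The integrand of the dual function of a polynomial average. -/
noncomputable def dualFun (S : Finset F[X]) (D : F[X]) (w f₀ : F → ℂ) (f : F[X] → F → ℂ) (y x : F) :
    ℂ :=
  w y * (f₀ (x - D.eval y) * ∏ P ∈ S.erase D, f P (x - D.eval y + P.eval y))

lemma norm_dualFun_le_one (S : Finset F[X]) (D : F[X]) {w f₀ : F → ℂ} {f : F[X] → F → ℂ}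
    (hw : ∀ y, ‖w y‖ ≤ 1) (hf₀ : ∀ x, ‖f₀ x‖ ≤ 1) (hf : ∀ P x, ‖f P x‖ ≤ 1) (y x : F) :
    ‖dualFun S D w f₀ f y x‖ ≤ 1 := by
  rw [dualFun, norm_mul, norm_mul]
  exact mul_le_one₀ (hw _) (by positivity)
    (mul_le_one₀ (hf₀ _) (norm_nonneg _) (norm_prod_le_one fun P => hf _ _))

lemma polyAvg_eq_expect_dualFun {S : Finset F[X]} {D : F[X]} (hD : D ∈ S) (w f₀ : F → ℂ)
    (f : F[X] → F → ℂ) : polyAvg S w f₀ f = 𝔼 x, f D x * 𝔼 y, dualFun S D w f₀ f y x := by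
  classical
  simp only [mul_expect]
  rw [polyAvg, expect_comm, expect_comm (f := fun x y => f D x * dualFun S D w f₀ f y x)]
  refine expect_congr rfl fun y _ => ?_
  rw [← expect_add_right (fun x => f D x * dualFun S D w f₀ f y x) (D.eval y)]
  refine expect_congr rfl fun x _ => ?_
  rw [dualFun, ← mul_prod_erase S _ hD, add_sub_cancel_right]
  ring

open Classical in
-- Cauchy–Schwarz in x bounds the left side by the mean square of the dual function, which is itself
-- a polynomial average with the conjugate dual function in place of `f D`.
lemma norm_polyAvg_sq_le {S : Finset F[X]} {D : F[X]} (hD : D ∈ S) (w f₀ : F → ℂ)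
    {f : F[X] → F → ℂ} (hf : ∀ P x, ‖f P x‖ ≤ 1) :
    ‖polyAvg S w f₀ f‖ ^ 2 ≤ ‖polyAvg S w f₀
      (Function.update f D fun x => conj (𝔼 y, dualFun S D w f₀ f y x))‖ := by
  have h1 : polyAvg S w f₀ (Function.update f D fun x => conj (𝔼 y, dualFun S D w f₀ f y x)) =
      ((𝔼 x, ‖𝔼 y, dualFun S D w f₀ f y x‖ ^ 2 : ℝ) : ℂ) := by
    rw [polyAvg_eq_expect_dualFun hD, Complex.ofReal_expect]
    refine expect_congr rfl fun x _ => ?_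
    rw [Function.update_self]
    have : ∀ y, dualFun S D w f₀ (Function.update f D fun x => conj (𝔼 y, dualFun S D w f₀ f y x))
        y x = dualFun S D w f₀ f y x := by
      intro y
      rw [dualFun, dualFun]
      congr 2
      refine prod_congr rfl fun P hP => ?_
      rw [Function.update_of_ne (ne_of_mem_erase hP)]
    simp only [this]
    rw [mul_comm, Complex.mul_conj']
    push_cast; rfl
  rw [h1, Complex.norm_real, polyAvg_eq_expect_dualFun hD]
  exact (norm_expect_mul_sq_le (hf D)).trans (le_abs_self _)

open Classical in
-- Translating x by D(y) splits the character into e(ξx) and e(ξD(y)). Fourier coefficients of dual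
-- functions are thereby averages along one polynomial fewer, the source of the induction.
lemma expect_dualFun_mul_char (S : Finset F[X]) (D : F[X]) (w f₀ : F → ℂ) (f : F[X] → F → ℂ)
    (ξ : F) : 𝔼 x, (𝔼 y, dualFun S D w f₀ f y x) * e (ξ * x) =
      polyAvg (S.erase D) (fun y => w y * e (ξ * D.eval y)) (fun x => f₀ x * e (ξ * x)) f := by
  simp only [expect_mul]
  rw [polyAvg, expect_comm, expect_comm (s := univ (α := F)) (t := univ (α := F))
    (f := fun x y => f₀ x * e (ξ * x) * (w y * e (ξ * D.eval y) * _))]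
  refine expect_congr rfl fun y _ => ?_
  rw [← expect_add_right (fun x => dualFun S D w f₀ f y x * e (ξ * x)) (D.eval y)]
  refine expect_congr rfl fun x _ => ?_
  rw [dualFun, add_sub_cancel_right, mul_add, AddChar.map_add_eq_mul]
  ring

open Classical in
-- The same translation for cubes. The unimodular weight cancels, so the only phase in y is ξD,
-- whatever the original phase was.
lemma expect_cube_dualFun (S : Finset F[X]) (D : F[X]) {w : F → ℂ} (hw : ∀ y, ‖w y‖ = 1)
    (f₀ : F → ℂ) (f : F[X] → F → ℂ) (k : ℕ) (h h' : Vec F (k + 1)) (ξ : F) :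
    𝔼 x, 𝔼 y, cube (k + 1) (fun v => dualFun S D w f₀ f y (x + vsum (k + 1) v)) h h' *
        e (ξ * x) =
      polyAvg (S.erase D) (fun y => e (ξ * D.eval y))
        (fun x => cube (k + 1) (fun v => f₀ (x + vsum (k + 1) v)) h h' * e (ξ * x))
        (fun P x => cube (k + 1) (fun v => f P (x + vsum (k + 1) v)) h h') := by
  rw [polyAvg, expect_comm, expect_comm (s := univ (α := F)) (t := univ (α := F))
    (f := fun x y => (cube (k + 1) (fun v => f₀ (x + vsum (k + 1) v)) h h' * e (ξ * x)) *
      (e (ξ * D.eval y) * _))]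
  refine expect_congr rfl fun y _ => ?_
  rw [← expect_add_right (fun x =>
    cube (k + 1) (fun v => dualFun S D w f₀ f y (x + vsum (k + 1) v)) h h' * e (ξ * x))
    (D.eval y)]
  refine expect_congr rfl fun x _ => ?_
  simp only [dualFun]
  rw [cube_mul, cube_const (hw y), cube_mul, cube_prod, one_mul, mul_add, AddChar.map_add_eq_mul]
  have h1 : ∀ v, x + D.eval y + vsum (k + 1) v - D.eval y = x + vsum (k + 1) v := fun v => by ring
  have h2 : ∀ v (P : F[X]), x + vsum (k + 1) v + P.eval y = x + P.eval y + vsum (k + 1) v :=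
    fun v P => by ring
  simp only [h1, h2]
  ring

end Dual

/-! ### Averages without a main term, from one polynomial fewer -/

section Main

/-- Power savings are carried in the form `z ^ N ≤ C / q`; raising to a further power brings two of
them to a common exponent. -/
lemma pow_mul_le_div {z C q : ℝ} {N M : ℕ} (hz : 0 ≤ z) (hC : 0 ≤ C) (hq : 1 ≤ q) (hM : M ≠ 0)
    (h : z ^ N ≤ C / q) : z ^ (N * M) ≤ C ^ M / q := by
  rw [pow_mul]
  refine (pow_le_pow_left₀ (by positivity) h M).trans ?_
  rw [div_pow]
  have : q ≤ q ^ M := le_self_pow₀ hq hM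
  gcongr

lemma add_pow_le_div {a b A B q : ℝ} {N M : ℕ} (ha : 0 ≤ a) (hb : 0 ≤ b) (hA : 0 ≤ A) (hB : 0 ≤ B)
    (hq : 1 ≤ q) (hN : N ≠ 0) (hM : M ≠ 0) (h : a ^ N ≤ A / q) (h' : b ^ M ≤ B / q) :
    (a + b) ^ (N * M) ≤ 2 ^ (N * M) * (A ^ M + B ^ N) / q := by
  have h1 := pow_mul_le_div ha hA hq hM h
  have h2 := pow_mul_le_div hb hB hq hN h'
  rw [mul_comm M N] at h2
  have h3 : (a + b) ^ (N * M) ≤ 2 ^ (N * M) * (a ^ (N * M) + b ^ (N * M)) := by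
    refine (add_pow_le ha hb (N * M)).trans ?_
    gcongr
    · norm_num
    · omega
  refine h3.trans ?_
  rw [mul_div_assoc, add_div]
  gcongr

lemma exists_pow_eq_div {C q : ℝ} (hC : 0 ≤ C) (hq : 1 ≤ q) {N : ℕ} (hN : N ≠ 0) :
    ∃ r : ℝ, 0 ≤ r ∧ r ^ N = C / q ∧ ∀ z : ℝ, 0 ≤ z → z ^ N ≤ C / q → z ≤ r := by
  have h0 : 0 ≤ C / q := by positivity
  have h1 := Real.rpow_inv_natCast_pow h0 hN
  have h2 : 0 ≤ (C / q) ^ ((N : ℝ)⁻¹) := by positivity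
  exact ⟨_, h2, h1, fun z hz h => le_of_pow_le_pow_left₀ hN h2 (h.trans h1.ge)⟩

open Classical in
/-- Equidistribution with a power saving for all averages along `n` linearly independent polynomials
of degree at most `d`, twisted by a polynomial phase. -/
def Equidist (d n N : ℕ) (C : ℝ) : Prop :=
  ∀ (F : Type u) [Field F] [Fintype F], d < ringChar F → ∀ e : AddChar F ℂ, e ≠ 1 →
    ∀ S : Finset F[X], S.card = n → LinearIndepOn F id (S : Set F[X]) →
    (∀ P ∈ S, P.coeff 0 = 0 ∧ P.natDegree ≤ d) →
    ∀ Q : F[X], Q.coeff 0 = 0 → Q.natDegree ≤ d → (Q = 0 ∨ Q ∉ Submodule.span F (S : Set F[X])) →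
    ∀ (f₀ : F → ℂ) (f : F[X] → F → ℂ), (∀ x, ‖f₀ x‖ ≤ 1) → (∀ P x, ‖f P x‖ ≤ 1) →
    ‖polyAvg S (fun y => e (Q.eval y)) f₀ f -
      (if Q = 0 then (𝔼 x, f₀ x) * ∏ P ∈ S, 𝔼 x, f P x else 0)‖ ^ N ≤ C / Fintype.card F

lemma equidist_zero (d : ℕ) : Equidist.{u} d 0 (2 ^ d) d := by
  intro F _ _ hd e he S hS _ _ Q hQ0 hQd _ f₀ f hf₀ _
  obtain rfl := card_eq_zero.1 hS
  have h1 : polyAvg ∅ (fun y => e (Q.eval y)) f₀ f = (𝔼 x, f₀ x) * 𝔼 y, e (Q.eval y) := by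
    rw [polyAvg, Fintype.expect_mul_expect]
    simp
  rw [h1, prod_empty, mul_one]
  split_ifs with hQ
  · subst hQ
    simp only [eval_zero, AddChar.map_zero_eq_one, Fintype.expect_const, mul_one, sub_self,
      norm_zero]
    rw [zero_pow (by positivity)]
    positivity
  · rw [sub_zero]
    obtain ⟨m, hm⟩ : ∃ m, Q.natDegree = m + 1 := by
      refine ⟨Q.natDegree - 1, ?_⟩
      have : Q.natDegree ≠ 0 := by
        intro h
        rw [eq_C_of_natDegree_eq_zero h, hQ0, C_0] at hQ
        exact hQ rfl
      omega
    have h2 : ‖𝔼 y, e (Q.eval y)‖ ≤ 1 := norm_expect_le_one fun y => by rw [AddChar.norm_apply]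
    calc ‖(𝔼 x, f₀ x) * 𝔼 y, e (Q.eval y)‖ ^ (2 ^ d) ≤ ‖𝔼 y, e (Q.eval y)‖ ^ (2 ^ d) := by
          rw [norm_mul]
          gcongr
          exact mul_le_of_le_one_left (norm_nonneg _) (norm_expect_le_one hf₀)
      _ ≤ ‖𝔼 y, e (Q.eval y)‖ ^ (2 ^ m) :=
          pow_le_pow_of_le_one (norm_nonneg _) h2 (Nat.pow_le_pow_right (by norm_num) (by omega))
      _ ≤ m / Fintype.card F := weyl_bound he m hm (by omega)
      _ ≤ d / Fintype.card F := by
          gcongr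
          omega

open Classical in
-- Induction on the order. The U² case combines the inverse theorem with `Equidist` for `S.erase D`;
-- higher orders follow by `degree_lowering`, whose hypothesis is `Equidist` with phase ξD. The
-- main-term condition omits D because the dual function does not involve `f D`.
lemma exists_dual_bound {d n N : ℕ} {C : ℝ} (hN : N ≠ 0) (hC : 0 ≤ C)
    (hE : Equidist.{u} d n N C) (k : ℕ) : ∃ (N' : ℕ) (C' : ℝ), N' ≠ 0 ∧ 0 ≤ C' ∧
      ∀ (F : Type u) [Field F] [Fintype F], d < ringChar F → ∀ e : AddChar F ℂ, e ≠ 1 →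
      ∀ S : Finset F[X], S.card = n + 1 → LinearIndepOn F id (S : Set F[X]) →
      (∀ P ∈ S, P.coeff 0 = 0 ∧ P.natDegree ≤ d) →
      ∀ Q : F[X], Q.coeff 0 = 0 → Q.natDegree ≤ d →
      (Q = 0 ∨ Q ∉ Submodule.span F (S : Set F[X])) →
      ∀ D ∈ S, ∀ (f₀ : F → ℂ) (f : F[X] → F → ℂ), (∀ x, ‖f₀ x‖ ≤ 1) → (∀ P x, ‖f P x‖ ≤ 1) →
      (Q ≠ 0 ∨ (𝔼 x, f₀ x) * ∏ P ∈ S.erase D, 𝔼 x, f P x = 0) →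
      gowersPow (k + 1) (fun x => 𝔼 y, dualFun S D (fun y => e (Q.eval y)) f₀ f y x) ^ N' ≤
        C' / Fintype.card F := by
  have hspan : ∀ (F : Type u) [Field F] [Fintype F] (S : Finset F[X]) (D : F[X]) (ξ : F),
      LinearIndepOn F id (S : Set F[X]) → D ∈ S → ξ ≠ 0 →
      Polynomial.C ξ * D ∉ Submodule.span F ((S.erase D : Finset F[X]) : Set F[X]) := by
    intro F _ _ S D ξ hli hD hξ hmem
    have h1 := hli.notMem_span hD
    rw [Set.image_id] at h1
    refine h1 ?_
    rw [← smul_eq_C_mul, Submodule.smul_mem_iff _ hξ] at hmem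
    simpa using hmem
  induction k with
  | zero =>
    refine ⟨N, C ^ 2, hN, by positivity, ?_⟩
    intro F _ _ hd e he S hS hli hSd Q hQ0 hQd hQ D hD f₀ f hf₀ hf hspec
    have hq := one_le_card_field F
    have hG : ∀ x, ‖𝔼 y, dualFun S D (fun y => e (Q.eval y)) f₀ f y x‖ ≤ 1 := fun x =>
      norm_expect_le_one fun y =>
        norm_dualFun_le_one S D (fun y => by rw [AddChar.norm_apply]) hf₀ hf y x
    obtain ⟨ξ, hξ⟩ := exists_gowersPow_one_le he hG
    rw [expect_dualFun_mul_char] at hξ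
    have hw : (fun y => e (Q.eval y) * e (ξ * D.eval y)) =
        fun y => e ((Q + Polynomial.C ξ * D).eval y) := by
      ext y; rw [← AddChar.map_add_eq_mul]; simp
    rw [hw] at hξ
    have hsub : Submodule.span F ((S.erase D : Finset F[X]) : Set F[X]) ≤
        Submodule.span F (S : Set F[X]) := Submodule.span_mono (by simp)
    have hDS : D ∈ Submodule.span F (S : Set F[X]) := Submodule.subset_span hD
    have hmul : ∀ η : F, Polynomial.C η * D ∈ Submodule.span F (S : Set F[X]) := fun η => by
      rw [← smul_eq_C_mul]; exact Submodule.smul_mem _ _ hDS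
    -- Only Q = ξ = 0 leaves a main term, which then vanishes by `hspec`. Otherwise the phase Q + ξD
    -- lies outside the span of the remaining polynomials.
    have hcases : (Q = 0 ∧ ξ = 0) ∨
        Q + Polynomial.C ξ * D ∉ Submodule.span F ((S.erase D : Finset F[X]) : Set F[X]) := by
      rcases hQ with rfl | hQ
      · by_cases h0 : ξ = 0
        · exact Or.inl ⟨rfl, h0⟩
        · right; rw [zero_add]; exact hspan F S D ξ hli hD h0
      · refine Or.inr fun hmem => hQ ?_
        have := Submodule.sub_mem _ (hsub hmem) (hmul ξ)
        rwa [add_sub_cancel_right] at this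
    have h2 := hE F hd e he (S.erase D) (by rw [card_erase_of_mem hD, hS]; rfl)
      (hli.mono (by simp)) (fun P hP => hSd P (mem_of_mem_erase hP)) (Q + Polynomial.C ξ * D)
      (by simp [hQ0, (hSd D hD).1])
      ((natDegree_add_le _ _).trans (max_le hQd ((natDegree_C_mul_le _ _).trans (hSd D hD).2)))
      (by
        rcases hcases with ⟨rfl, rfl⟩ | h
        · left; simp
        · exact Or.inr h)
      (fun x => f₀ x * e (ξ * x)) f
      (fun x => by rw [norm_mul, AddChar.norm_apply, mul_one]; exact hf₀ x) hf
    have h3 : (if Q + Polynomial.C ξ * D = 0 then (𝔼 x, f₀ x * e (ξ * x)) *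
        ∏ P ∈ S.erase D, 𝔼 x, f P x else 0) = 0 := by
      split_ifs with h0
      · rcases hcases with ⟨rfl, rfl⟩ | h
        · simpa using hspec
        · exact absurd (h0 ▸ Submodule.zero_mem _) h
      · rfl
    rw [h3, sub_zero] at h2
    have h4 := pow_mul_le_div (norm_nonneg _) hC hq two_ne_zero h2
    refine (pow_le_pow_left₀ (gowersPow_nonneg _ _) hξ N).trans ?_
    rw [← pow_mul, mul_comm 2 N]
    exact h4
  | succ k ih =>
    obtain ⟨N', C', hN', hC', ih⟩ := ih
    refine ⟨2 ^ (k + 1 + 1) * ((2 ^ (k + 1) * N') * N),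
      2 ^ ((2 ^ (k + 1) * N') * N) * (C' ^ N + (C ^ 2) ^ (2 ^ (k + 1) * N')), by positivity,
      by positivity, ?_⟩
    intro F _ _ hd e he S hS hli hSd Q hQ0 hQd hQ D hD f₀ f hf₀ hf hspec
    have hq := one_le_card_field F
    obtain ⟨r, hr0, hrN, hr⟩ := exists_pow_eq_div hC hq hN
    have hw1 : ∀ y, ‖e (Q.eval y)‖ = 1 := fun y => AddChar.norm_apply _ _
    obtain ⟨ρ, hρ0, hρ, hρU⟩ := degree_lowering he (k + 1)
      (norm_dualFun_le_one S D (fun y => (hw1 y).le) hf₀ hf) (ε := r ^ 2) (by positivity) (by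
        intro h h' ξ hξ
        rw [expect_cube_dualFun S D hw1]
        refine pow_le_pow_left₀ (norm_nonneg _) (hr _ (norm_nonneg _) ?_) 2
        have hcb : ∀ g : F → ℂ, (∀ x, ‖g x‖ ≤ 1) → ∀ x,
            ‖cube (k + 1) (fun v => g (x + vsum (k + 1) v)) h h'‖ ≤ 1 := fun g hg x =>
          (norm_cube_le (fun v => hg _) h h').trans (hg _)
        have h2 := hE F hd e he (S.erase D) (by rw [card_erase_of_mem hD, hS]; rfl)
          (hli.mono (by simp)) (fun P hP => hSd P (mem_of_mem_erase hP)) (Polynomial.C ξ * D)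
          (by simp [(hSd D hD).1]) ((natDegree_C_mul_le _ _).trans (hSd D hD).2)
          (Or.inr (hspan F S D ξ hli hD hξ))
          (fun x => cube (k + 1) (fun v => f₀ (x + vsum (k + 1) v)) h h' * e (ξ * x))
          (fun P x => cube (k + 1) (fun v => f P (x + vsum (k + 1) v)) h h')
          (fun x => by rw [norm_mul, AddChar.norm_apply, mul_one]; exact hcb _ hf₀ x)
          (fun P => hcb _ (hf P))
        have h3 : Polynomial.C ξ * D ≠ 0 := fun h0 => hspan F S D ξ hli hD hξ (h0 ▸ Submodule.zero_mem _)
        rw [if_neg h3, sub_zero] at h2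
        simpa only [eval_mul, eval_C] using h2)
    have h1 : ρ ^ (2 ^ (k + 1) * N') ≤ C' / Fintype.card F := by
      rw [pow_mul]
      exact (pow_le_pow_left₀ (by positivity) hρ N').trans
        (ih F hd e he S hS hli hSd Q hQ0 hQd hQ D hD f₀ f hf₀ hf hspec)
    have h2 : (r ^ 2) ^ N ≤ C ^ 2 / Fintype.card F := by
      rw [← pow_mul, mul_comm]
      exact pow_mul_le_div hr0 hC hq two_ne_zero hrN.le
    rw [pow_mul]
    refine (pow_le_pow_left₀ (pow_nonneg (gowersPow_nonneg _ _) _) hρU _).trans ?_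
    exact add_pow_le_div hρ0 (by positivity) hC' (by positivity) hq (by positivity) hN h1 h2

open Classical in
lemma exists_special_bound {d n N : ℕ} {C : ℝ} (hN : N ≠ 0) (hC : 0 ≤ C)
    (hE : Equidist.{u} d n N C) : ∃ (N' : ℕ) (C' : ℝ), N' ≠ 0 ∧ 0 ≤ C' ∧
      ∀ (F : Type u) [Field F] [Fintype F], d < ringChar F → ∀ e : AddChar F ℂ, e ≠ 1 →
      ∀ S : Finset F[X], S.card = n + 1 → LinearIndepOn F id (S : Set F[X]) →
      (∀ P ∈ S, P.coeff 0 = 0 ∧ P.natDegree ≤ d) →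
      ∀ Q : F[X], Q.coeff 0 = 0 → Q.natDegree ≤ d →
      (Q = 0 ∨ Q ∉ Submodule.span F (S : Set F[X])) →
      ∃ D ∈ S, ∀ (f₀ : F → ℂ) (f : F[X] → F → ℂ), (∀ x, ‖f₀ x‖ ≤ 1) → (∀ P x, ‖f P x‖ ≤ 1) →
      (Q ≠ 0 ∨ (𝔼 x, f₀ x) * ∏ P ∈ S.erase D, 𝔼 x, f P x = 0) →
      ‖polyAvg S (fun y => e (Q.eval y)) f₀ f‖ ^ N' ≤ C' / Fintype.card F := by
  obtain ⟨m, hm⟩ := exists_petBound.{u} d (n + 1)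
  -- `exists_dual_bound` counts orders from U², hence `m - 1`, where `m` is nonzero.
  obtain ⟨N', C', hN', hC', hdual⟩ := exists_dual_bound hN hC hE (m - 1)
  refine ⟨2 * (2 ^ (2 * m) * N'), (2 ^ (3 ^ m)) ^ N' * (2 ^ N' * (C' + 1)), by positivity,
    by positivity, ?_⟩
  intro F _ _ hd e he S hS hli hSd Q hQ0 hQd hQ
  -- PET induction gives control only through the function at a polynomial of maximal degree.
  obtain ⟨D, hD, hmax⟩ := exists_max_image S natDegree (card_pos.1 (by omega))
  refine ⟨D, hD, fun f₀ f hf₀ hf hspec => ?_⟩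
  have hq := one_le_card_field F
  have hw1 : ∀ y, ‖e (Q.eval y)‖ ≤ 1 := fun y => (AddChar.norm_apply _ _).le
  set G : F → ℂ := fun x => 𝔼 y, dualFun S D (fun y => e (Q.eval y)) f₀ f y x with hGdef
  have hG : ∀ x, ‖G x‖ ≤ 1 := fun x =>
      norm_expect_le_one fun y => norm_dualFun_le_one S D hw1 hf₀ hf y x
  have h1 := norm_polyAvg_sq_le hD (fun y => e (Q.eval y)) f₀ hf
  obtain ⟨hm0, h2⟩ := hm F hd S D hD (fun P hP => ⟨hli.ne_zero hP, (hSd P hP).1, hmax P hP⟩)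
    (hSd D hD).2 hS.le (fun y => e (Q.eval y)) f₀
    (Function.update f D fun x => conj (G x)) hw1 hf₀ (fun P x => by
      by_cases hP : P = D
      · subst hP; rw [Function.update_self, RCLike.norm_conj]; exact hG x
      · rw [Function.update_of_ne hP]; exact hf P x)
  have h3 := hdual F hd e he S hS hli hSd Q hQ0 hQd hQ D hD f₀ f hf₀ hf hspec
  rw [Nat.sub_add_cancel (Nat.one_le_iff_ne_zero.2 hm0)] at h3
  rw [Dominated, Function.update_self, gowersPow_conj] at h2
  have hU0 := gowersPow_nonneg m G
  have h4 : (gowersPow m G + 1 / Fintype.card F) ^ N' ≤ 2 ^ N' * (C' + 1) / Fintype.card F := by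
    have h5 : (1 / (Fintype.card F : ℝ)) ^ N' ≤ 1 / Fintype.card F := by
      refine pow_le_of_le_one (by positivity) ?_ hN'
      rw [div_le_one (by linarith)]; exact hq
    refine (add_pow_le hU0 (by positivity) N').trans ?_
    rw [mul_div_assoc, add_div]
    have : (2 : ℝ) ^ (N' - 1) ≤ 2 ^ N' := pow_le_pow_right₀ (by norm_num) (by omega)
    gcongr
  generalize ‖polyAvg S (fun y => e (Q.eval y)) f₀ (Function.update f D fun x => conj (G x))‖ = b
    at h1 h2
  rw [pow_mul, pow_mul]
  calc _ ≤ (b ^ 2 ^ (2 * m)) ^ N' :=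
        pow_le_pow_left₀ (by positivity) (pow_le_pow_left₀ (by positivity) h1 _) _
    _ ≤ (2 ^ (3 ^ m) * (gowersPow m G + 1 / Fintype.card F)) ^ N' :=
        pow_le_pow_left₀ (pow_nonneg ((sq_nonneg _).trans h1) _) h2 _
    _ ≤ _ := by
        rw [mul_pow, mul_div_assoc]
        exact mul_le_mul_of_nonneg_left h4 (by positivity)

end Main

/-! ### Separating off the means -/

section Telescope

set_option linter.unusedSectionVars false

variable {F : Type u} [Field F] [Fintype F]

lemma norm_half_sub_le_one {a b : ℂ} (ha : ‖a‖ ≤ 1) (hb : ‖b‖ ≤ 1) : ‖(a - b) / 2‖ ≤ 1 := by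
  rw [norm_div, Complex.norm_two, div_le_one two_pos]
  exact (norm_sub_le _ _).trans (by linarith)

lemma expect_half_sub_expect (f : F → ℂ) : 𝔼 x, (f x - 𝔼 z, f z) / 2 = 0 := by
  rw [← expect_div, expect_sub_distrib, Fintype.expect_const, sub_self, zero_div]

open Classical in
lemma polyAvg_update {S : Finset F[X]} {P : F[X]} (hP : P ∈ S) (w f₀ : F → ℂ) (f : F[X] → F → ℂ)
    (g : F → ℂ) : polyAvg S w f₀ (Function.update f P g) =
      𝔼 x, 𝔼 y, f₀ x * (w y * (g (x + P.eval y) * ∏ R ∈ S.erase P, f R (x + R.eval y))) := by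
  refine expect_congr rfl fun x _ => expect_congr rfl fun y _ => ?_
  rw [← mul_prod_erase S _ hP, Function.update_self]
  congr 3
  exact prod_congr rfl fun R hR => by rw [Function.update_of_ne (ne_of_mem_erase hR)]

open Classical in
/-- If averages with a function of mean zero are small, then all averages are close to the product
of the means. -/
lemma norm_polyAvg_sub_prod_le {S : Finset F[X]} {D : F[X]} (hD : D ∈ S) {r : ℝ}
    (H : ∀ (f₀ : F → ℂ) (f : F[X] → F → ℂ), (∀ x, ‖f₀ x‖ ≤ 1) → (∀ P x, ‖f P x‖ ≤ 1) →
      (𝔼 x, f₀ x) * ∏ P ∈ S.erase D, 𝔼 x, f P x = 0 → ‖polyAvg S (fun _ => 1) f₀ f‖ ≤ r)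
    {f₀ : F → ℂ} {f : F[X] → F → ℂ} (hf₀ : ∀ x, ‖f₀ x‖ ≤ 1) (hf : ∀ P x, ‖f P x‖ ≤ 1) :
    ‖polyAvg S (fun _ => 1) f₀ f - (𝔼 x, f₀ x) * ∏ P ∈ S, 𝔼 x, f P x‖ ≤ 2 * S.card * r := by
  have h1F : ∀ x : F, ‖(fun _ : F => (1 : ℂ)) x‖ ≤ 1 := fun _ => by simp
  have hmean : ∀ P, ‖𝔼 x, f P x‖ ≤ 1 := fun P => norm_expect_le_one (hf P)
  -- Half of a centred function is again bounded by 1, so extracting one mean costs 2r.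
  have step0 : ‖polyAvg S (fun _ => 1) f₀ f -
      (𝔼 x, f₀ x) * polyAvg S (fun _ => 1) (fun _ => 1) f‖ ≤ 2 * r := by
    have h1 : polyAvg S (fun _ => 1) f₀ f -
        (𝔼 x, f₀ x) * polyAvg S (fun _ => 1) (fun _ => 1) f =
        2 * polyAvg S (fun _ => 1) (fun x => (f₀ x - 𝔼 z, f₀ z) / 2) f := by
      simp only [polyAvg, mul_expect, ← expect_sub_distrib]
      refine expect_congr rfl fun x _ => expect_congr rfl fun y _ => ?_
      ring
    rw [h1, norm_mul, Complex.norm_two]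
    refine mul_le_mul_of_nonneg_left (H _ _ (fun x => ?_) hf ?_) two_pos.le
    · exact norm_half_sub_le_one (hf₀ x) (norm_expect_le_one hf₀)
    · rw [expect_half_sub_expect, zero_mul]
  -- `f D` is never centred, as `H` does not cover that case. Once the other functions are constant,
  -- the average is exactly the mean of `f D` (see `last`).
  have step : ∀ T ⊆ S.erase D, ‖polyAvg S (fun _ => 1) (fun _ => 1) f - (∏ P ∈ T, 𝔼 x, f P x) *
      polyAvg S (fun _ => 1) (fun _ => 1) (fun P => if P ∈ T then fun _ => 1 else f P)‖ ≤
      2 * T.card * r := by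
    intro T hT
    induction T using Finset.induction_on with
    | empty => simp
    | insert P T hPT ih =>
      have hPS : P ∈ S.erase D := hT (mem_insert_self _ _)
      set g : F[X] → F → ℂ := fun R => if R ∈ T then fun _ => 1 else f R with hg
      have hg1 : ∀ R x, ‖g R x‖ ≤ 1 := by
        intro R x
        simp only [hg]
        split_ifs
        · simp
        · exact hf R x
      have e1 : (fun R => if R ∈ insert P T then fun _ => 1 else f R) =
          Function.update g P fun _ => 1 := by
        ext R x
        by_cases hR : R = P
        · subst hR; simp
        · rw [Function.update_of_ne hR]; simp [hg, hR]
      have e2 : g = Function.update g P (f P) := by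
        rw [eq_comm, Function.update_eq_self_iff]; simp [hg, hPT]
      have e3 : polyAvg S (fun _ => 1) (fun _ => 1) g - (𝔼 x, f P x) *
          polyAvg S (fun _ => 1) (fun _ => 1) (Function.update g P fun _ => 1) =
          2 * polyAvg S (fun _ => 1) (fun _ => 1)
            (Function.update g P fun x => (f P x - 𝔼 z, f P z) / 2) := by
        conv_lhs => rw [e2]
        simp only [polyAvg_update (mem_of_mem_erase hPS), Function.update_idem, mul_expect,
          ← expect_sub_distrib]
        refine expect_congr rfl fun x _ => expect_congr rfl fun y _ => ?_
        have : ∏ R ∈ S.erase P, Function.update g P (f P) R (x + R.eval y) =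
            ∏ R ∈ S.erase P, g R (x + R.eval y) :=
          prod_congr rfl fun R hR => by rw [Function.update_of_ne (ne_of_mem_erase hR)]
        ring
      have e4 : ‖polyAvg S (fun _ => 1) (fun _ => 1) g - (𝔼 x, f P x) *
          polyAvg S (fun _ => 1) (fun _ => 1) (Function.update g P fun _ => 1)‖ ≤ 2 * r := by
        rw [e3, norm_mul, Complex.norm_two]
        refine mul_le_mul_of_nonneg_left (H _ _ h1F (fun R x => ?_) ?_) two_pos.le
        · by_cases hR : R = P
          · subst hR; rw [Function.update_self]
            exact norm_half_sub_le_one (hf R x) (hmean R)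
          · rw [Function.update_of_ne hR]; exact hg1 R x
        · rw [prod_eq_zero hPS, mul_zero]
          rw [Function.update_self, expect_half_sub_expect]
      rw [e1, prod_insert hPT, card_insert_of_notMem hPT]
      have e5 : polyAvg S (fun _ => 1) (fun _ => 1) f - (𝔼 x, f P x) * (∏ R ∈ T, 𝔼 x, f R x) *
          polyAvg S (fun _ => 1) (fun _ => 1) (Function.update g P fun _ => 1) =
          (polyAvg S (fun _ => 1) (fun _ => 1) f - (∏ R ∈ T, 𝔼 x, f R x) *
            polyAvg S (fun _ => 1) (fun _ => 1) g) +
          (∏ R ∈ T, 𝔼 x, f R x) * (polyAvg S (fun _ => 1) (fun _ => 1) g - (𝔼 x, f P x) *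
            polyAvg S (fun _ => 1) (fun _ => 1) (Function.update g P fun _ => 1)) := by ring
      rw [e5]
      refine (norm_add_le _ _).trans ?_
      have e6 := ih ((subset_insert _ _).trans hT)
      have e7 : ‖(∏ R ∈ T, 𝔼 x, f R x) * (polyAvg S (fun _ => 1) (fun _ => 1) g - (𝔼 x, f P x) *
            polyAvg S (fun _ => 1) (fun _ => 1) (Function.update g P fun _ => 1))‖ ≤ 2 * r := by
        rw [norm_mul]
        exact (mul_le_of_le_one_left (norm_nonneg _) (norm_prod_le_one hmean)).trans e4
      push_cast
      linarith
  have last : polyAvg S (fun _ => 1) (fun _ => 1)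
      (fun P => if P ∈ S.erase D then fun _ => 1 else f P) = 𝔼 x, f D x := by
    rw [polyAvg, expect_comm]
    have h1 : ∀ y : F, (𝔼 x, 1 * (1 * ∏ P ∈ S,
        (if P ∈ S.erase D then fun _ => 1 else f P) (x + P.eval y))) = 𝔼 x, f D x := by
      intro y
      rw [← expect_add_right (f D) (D.eval y)]
      refine expect_congr rfl fun x _ => ?_
      rw [← mul_prod_erase S _ hD, prod_eq_one]
      · simp
      · intro P hP; rw [if_pos hP]
    simp only [h1, Fintype.expect_const]
  have hfin := step _ Subset.rfl
  rw [last] at hfin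
  rw [← prod_erase_mul S _ hD]
  have e5 : polyAvg S (fun _ => 1) f₀ f - (𝔼 x, f₀ x) * ((∏ P ∈ S.erase D, 𝔼 x, f P x) *
      𝔼 x, f D x) = (polyAvg S (fun _ => 1) f₀ f -
      (𝔼 x, f₀ x) * polyAvg S (fun _ => 1) (fun _ => 1) f) +
      (𝔼 x, f₀ x) * (polyAvg S (fun _ => 1) (fun _ => 1) f - (∏ P ∈ S.erase D, 𝔼 x, f P x) *
      𝔼 x, f D x) := by ring
  rw [e5]
  refine (norm_add_le _ _).trans ?_
  have e7 : ‖(𝔼 x, f₀ x) * (polyAvg S (fun _ => 1) (fun _ => 1) f -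
      (∏ P ∈ S.erase D, 𝔼 x, f P x) * 𝔼 x, f D x)‖ ≤ 2 * (S.erase D).card * r := by
    rw [norm_mul]
    exact (mul_le_of_le_one_left (norm_nonneg _) (norm_expect_le_one hf₀)).trans hfin
  rw [card_erase_of_mem hD, Nat.cast_sub (card_pos.2 ⟨D, hD⟩)] at e7
  push_cast at e7
  linarith

end Telescope

/-! ### Induction on the number of polynomials -/

theorem exists_equidist (d n : ℕ) : ∃ (N : ℕ) (C : ℝ), N ≠ 0 ∧ 0 ≤ C ∧ Equidist.{u} d n N C := by
  induction n with
  | zero => exact ⟨2 ^ d, d, by positivity, by positivity, equidist_zero d⟩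
  | succ n ih =>
    obtain ⟨N₀, C₀, hN₀, hC₀, hE⟩ := ih
    obtain ⟨N, C, hN, hC, hspec⟩ := exists_special_bound hN₀ hC₀ hE
    refine ⟨N, (2 * (n + 1 : ℕ)) ^ N * C, hN, by positivity, ?_⟩
    intro F _ _ hd e he S hS hli hSd Q hQ0 hQd hQ f₀ f hf₀ hf
    obtain ⟨D, hD, hDspec⟩ := hspec F hd e he S hS hli hSd Q hQ0 hQd hQ
    have hq := one_le_card_field F
    obtain ⟨r, hr0, hrN, hr⟩ := exists_pow_eq_div hC hq hN
    split_ifs with h0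
    · subst h0
      simp only [eval_zero, AddChar.map_zero_eq_one] at hDspec ⊢
      have h1 := norm_polyAvg_sub_prod_le hD (r := r) (fun f₀ f hf₀ hf h =>
        hr _ (norm_nonneg _) (hDspec f₀ f hf₀ hf (Or.inr h))) hf₀ hf
      refine (pow_le_pow_left₀ (norm_nonneg _) h1 N).trans ?_
      rw [mul_pow, hrN, hS, mul_div_assoc]
    · rw [sub_zero]
      refine (hDspec f₀ f hf₀ hf (Or.inl h0)).trans ?_
      gcongr
      refine le_mul_of_one_le_left hC (one_le_pow₀ ?_)
      push_cast
      have : (0 : ℝ) ≤ n := by positivity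
      linarith

/-! ### Reduction of integer polynomials and counting by indicators -/

section Transfer

set_option linter.unusedSectionVars false

/-- Linear independence over `ℚ` persists in all fields of large characteristic. -/
lemma exists_linearIndependent_of_lt_ringChar {m : ℕ} {P : Fin m → ℤ[X]}
    (hP : LinearIndependent ℚ fun i => (P i).map (Int.castRingHom ℚ)) :
    ∃ M : ℕ, ∀ (F : Type u) [Field F], M < ringChar F →
      LinearIndependent F fun i => (P i).map (Int.castRingHom F) := by
  -- A rational left inverse, cleared of denominators, gives an integer matrix `B` whose product
  -- with the coefficient matrix is `b` times the identity. This forces independence wherever `b` is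
  -- nonzero, in particular in characteristic above |b|.
  obtain ⟨g, hg⟩ := LinearMap.exists_leftInverse_of_injective
    (Finsupp.linearCombination ℚ fun i => (P i).map (Int.castRingHom ℚ))
    (LinearMap.ker_eq_bot.2 hP)
  set d := univ.sup fun i => (P i).natDegree with hd
  have hPd : ∀ i, (P i).natDegree ≤ d := fun i => le_sup (f := fun i => (P i).natDegree) (mem_univ i)
  have hgP : ∀ i j, ∑ k : Fin (d + 1), ((P j).coeff k : ℚ) * g (X ^ (k : ℕ)) i =
      if i = j then 1 else 0 := by
    intro i j
    have h1 : (P j).map (Int.castRingHom ℚ) =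
        ∑ k : Fin (d + 1), ((P j).coeff k : ℚ) • (X : ℚ[X]) ^ (k : ℕ) := by
      rw [Fin.sum_univ_eq_sum_range (fun k => ((P j).coeff k : ℚ) • (X : ℚ[X]) ^ k)]
      conv_lhs => rw [as_sum_range' _ (d + 1)
        (Nat.lt_succ_of_le (natDegree_map_le.trans (hPd j)))]
      refine sum_congr rfl fun k _ => ?_
      rw [← smul_X_eq_monomial, coeff_map]; rfl
    have h2 := congrArg (fun L => L (Finsupp.single j 1) i) hg
    simp only [LinearMap.comp_apply, Finsupp.linearCombination_single, one_smul, LinearMap.id_apply,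
      Finsupp.single_apply] at h2
    rw [h1] at h2
    simp only [map_sum, map_smul, Finsupp.coe_finsetSum, Finset.sum_apply, Finsupp.smul_apply,
      smul_eq_mul] at h2
    rw [h2]
    simp only [eq_comm]
  obtain ⟨b, hb⟩ := IsLocalization.exist_integer_multiples_of_finite (nonZeroDivisors ℤ)
    fun z : Fin m × Fin (d + 1) => g (X ^ (z.2 : ℕ)) z.1
  choose B hB using hb
  have hb0 : (b : ℤ) ≠ 0 := nonZeroDivisors.ne_zero b.2
  have hint : ∀ i j, ∑ k : Fin (d + 1), (P j).coeff k * B (i, k) = if i = j then (b : ℤ) else 0 := by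
    intro i j
    have h1 : ((∑ k : Fin (d + 1), (P j).coeff k * B (i, k) : ℤ) : ℚ) =
        ((if i = j then (b : ℤ) else 0 : ℤ) : ℚ) := by
      push_cast
      have h2 : ∀ k : Fin (d + 1), (B (i, k) : ℚ) = (b : ℤ) * g (X ^ (k : ℕ)) i := by
        intro k
        have := hB (i, k)
        simpa [zsmul_eq_mul] using this
      simp only [h2]
      rw [sum_congr rfl fun k _ => mul_left_comm _ _ _, ← mul_sum, hgP]
      split_ifs <;> simp
    exact_mod_cast h1
  refine ⟨(b : ℤ).natAbs, fun F _ hF => ?_⟩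
  rw [Fintype.linearIndependent_iff]
  intro c hc i
  have hbF : ((b : ℤ) : F) ≠ 0 := by
    rw [Ne, CharP.intCast_eq_zero_iff F (ringChar F), Int.natCast_dvd]
    exact fun hdvd => absurd (Nat.le_of_dvd (Int.natAbs_pos.2 hb0) hdvd) (not_le.2 hF)
  have h1 : ∀ k, ∑ j, c j * ((P j).coeff k : F) = 0 := by
    intro k
    have := congrArg (fun R => R.coeff k) hc
    simpa [finsetSum_coeff] using this
  have h2 : ∑ k : Fin (d + 1), (B (i, k) : F) * ∑ j, c j * ((P j).coeff k : F) = 0 := by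
    simp [h1]
  simp only [mul_sum] at h2
  rw [sum_comm] at h2
  have h3 : ∀ j, ∑ k : Fin (d + 1), (B (i, k) : F) * (c j * ((P j).coeff k : F)) =
      c j * if i = j then ((b : ℤ) : F) else 0 := by
    intro j
    have := congrArg (fun n : ℤ => (n : F)) (hint i j)
    push_cast at this
    rw [← this, mul_sum]
    exact sum_congr rfl fun k _ => by ring
  simp only [h3, mul_ite, mul_zero, sum_ite_eq, mem_univ, if_true] at h2
  exact (mul_eq_zero.1 h2).resolve_right hbF

variable {F : Type u} [Field F] [Fintype F]

lemma aeval_eq_eval_map (p : ℤ[X]) (y : F) : aeval y p = (p.map (Int.castRingHom F)).eval y := by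
  rw [aeval_def, eval_map]; rfl

open Classical in
lemma polyAvg_indicator {m : ℕ} {P : Fin m → ℤ[X]}
    (hinj : Function.Injective fun i => (P i).map (Int.castRingHom F)) (A : Finset F) :
    polyAvg (univ.image fun i => (P i).map (Int.castRingHom F)) (fun _ => 1)
      (fun x => if x ∈ A then 1 else 0) (fun _ x => if x ∈ A then 1 else 0) =
      (progCount P A : ℂ) / (Fintype.card F : ℂ) ^ 2 := by
  have h1 : ∀ x y : F, (if x ∈ A then (1 : ℂ) else 0) *
      (1 * ∏ R ∈ univ.image fun i => (P i).map (Int.castRingHom F),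
        if x + R.eval y ∈ A then 1 else 0) = if ProgIn P A x y then 1 else 0 := by
    intro x y
    rw [prod_image fun i _ j _ h => hinj h, one_mul, ProgIn]
    simp only [aeval_eq_eval_map]
    by_cases hx : x ∈ A
    · by_cases hi : ∀ i, x + ((P i).map (Int.castRingHom F)).eval y ∈ A
      · simp [hx, hi]
      · rw [if_neg (c := _ ∧ _) (fun h => hi h.2)]
        push Not at hi
        obtain ⟨i, hi⟩ := hi
        rw [prod_eq_zero (mem_univ i) (if_neg hi), mul_zero]
    · simp [hx]
  simp only [polyAvg, h1]
  rw [← expect_prod_type (fun z : F × F => if ProgIn P A z.1 z.2 then (1 : ℂ) else 0),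
    Fintype.expect_eq_sum_div_card, sum_boole, Fintype.card_prod, progCount]
  push_cast
  rw [sq]

lemma expect_indicator_eq [DecidableEq F] (A : Finset F) :
    𝔼 x, (if x ∈ A then (1 : ℂ) else 0) = (A.card : ℂ) / Fintype.card F := by
  rw [Fintype.expect_eq_sum_div_card, sum_boole]
  simp

/-- Only pairs with y = 0 are counted, so x determines the pair. -/
lemma progCount_le_card {m : ℕ} {P : Fin m → ℤ[X]} {A : Finset F} (hA : ProgFree P A) :
    progCount P A ≤ Fintype.card F := by
  classical
  rw [progCount, ← card_univ]
  refine card_le_card_of_injOn Prod.fst (fun _ _ => mem_coe.2 (mem_univ _)) ?_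
  intro z hz z' hz' h
  have h0 : ∀ z : F × F, ProgIn P A z.1 z.2 → z.2 = 0 := fun z hz => by
    by_contra hne
    exact hA _ _ hne hz
  exact Prod.ext h ((h0 z (mem_filter.1 hz).2).trans (h0 z' (mem_filter.1 hz').2).symm)

end Transfer

/-- Power-saving equidistribution of polynomial progressions, in normalized form. -/
theorem exists_progCount_bound {m : ℕ} {P : Fin m → ℤ[X]} (hP0 : ∀ i, (P i).coeff 0 = 0)
    (hP : LinearIndependent ℚ fun i => (P i).map (Int.castRingHom ℚ)) :
    ∃ (c N : ℕ) (C : ℝ), N ≠ 0 ∧ 0 ≤ C ∧ ∀ (F : Type u) [Field F] [Fintype F], c < ringChar F →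
      ∀ A : Finset F, |(progCount P A : ℝ) / (Fintype.card F : ℝ) ^ 2 -
        ((A.card : ℝ) / Fintype.card F) ^ (m + 1)| ^ N ≤ C / Fintype.card F := by
  classical
  obtain ⟨M, hM⟩ := exists_linearIndependent_of_lt_ringChar.{u} hP
  set d := univ.sup fun i => (P i).natDegree with hd
  obtain ⟨N, C, hN, hC, hE⟩ := exists_equidist.{u} d m
  refine ⟨max d M, N, C, hN, hC, fun F _ _ hF A => ?_⟩
  have hli := hM F (lt_of_le_of_lt (le_max_right _ _) hF)
  -- The phase Q is 0 here, so any nontrivial character serves.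
  obtain ⟨e, he⟩ := (AddChar.exists_apply_ne_zero (a := (1 : F))).2 one_ne_zero
  have he1 : e ≠ 1 := by rintro rfl; simp at he
  set S : Finset F[X] := univ.image fun i => (P i).map (Int.castRingHom F) with hS
  have h := hE F (lt_of_le_of_lt (le_max_left _ _) hF) e he1 S
    (by rw [hS, card_image_of_injective _ hli.injective, card_univ, Fintype.card_fin])
    (by rw [hS, coe_image, coe_univ, Set.image_univ]; exact hli.linearIndepOn_id)
    (by
      intro R hR
      obtain ⟨i, -, rfl⟩ := mem_image.1 hR
      refine ⟨by simp [hP0 i], natDegree_map_le.trans ?_⟩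
      exact le_sup (f := fun i => (P i).natDegree) (mem_univ i))
    0 (by simp) (by simp) (Or.inl rfl) (fun x => if x ∈ A then 1 else 0)
    (fun _ x => if x ∈ A then 1 else 0) (fun x => by split_ifs <;> simp)
    (fun _ x => by split_ifs <;> simp)
  simp only [eval_zero, AddChar.map_zero_eq_one, if_true] at h
  rw [polyAvg_indicator hli.injective, expect_indicator_eq, prod_const, hS,
    card_image_of_injective _ hli.injective, card_univ, Fintype.card_fin, ← pow_succ'] at h
  have h2 : ((progCount P A : ℂ) / (Fintype.card F : ℂ) ^ 2 -
      ((A.card : ℂ) / Fintype.card F) ^ (m + 1)) =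
      (((progCount P A : ℝ) / (Fintype.card F : ℝ) ^ 2 -
        ((A.card : ℝ) / Fintype.card F) ^ (m + 1) : ℝ) : ℂ) := by push_cast; rfl
  rw [h2, Complex.norm_real, Real.norm_eq_abs] at h
  exact h

end PolyProg

/-! ### From the normalized bound to the two estimates -/

theorem theorem1 (m : ℕ) (P : Fin m → ℤ[X])
    (hP0 : ∀ i, (P i).coeff 0 = 0)
    (hP : LinearIndependent ℚ fun i => (P i).map (Int.castRingHom ℚ)) :
    ∃ c γ C : ℝ, 0 < c ∧ 0 < γ ∧ 0 < C ∧
      ∀ (F : Type*) [Field F] [Fintype F], c ≤ (ringChar F : ℝ) →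
        (PolyProg.r P F : ℝ) ≤ C * (Fintype.card F : ℝ) ^ (1 - γ) ∧
        ∀ A : Finset F,
          |(PolyProg.progCount P A : ℝ) -
              (A.card : ℝ) ^ (m + 1) / (Fintype.card F : ℝ) ^ ((m : ℤ) - 1)| ≤
            C * (Fintype.card F : ℝ) ^ (2 - ((m : ℝ) + 1) * γ) := by
  obtain ⟨c, N, C, hN, hC, h⟩ := PolyProg.exists_progCount_bound hP0 hP
  have hN' : (0 : ℝ) < N := by exact_mod_cast Nat.pos_of_ne_zero hN
  -- The count saves q^{1/N}; an (m+1)-st root turns this into the saving for the size of A.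
  set γ : ℝ := 1 / (N * (m + 1)) with hγ
  have hγm : ((m : ℝ) + 1) * γ = 1 / N := by rw [hγ]; field_simp
  have hγ0 : 0 < γ := by rw [hγ]; positivity
  set K : ℝ := C ^ (1 / (N : ℝ)) with hK
  have hK0 : 0 ≤ K := by positivity
  -- `c + 1` makes the bound on the characteristic strict. The extra 1 in `K + 1` gives positivity
  -- and absorbs the progressions with y = 0.
  refine ⟨c + 1, γ, K + 1, by positivity, hγ0, by positivity, fun F _ _ hF => ?_⟩
  have hF' : c < ringChar F := by exact_mod_cast (lt_add_one (c : ℝ)).trans_le hF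
  set q : ℝ := (Fintype.card F : ℝ) with hq
  have hq1 : 1 ≤ q := PolyProg.one_le_card_field F
  have hq0 : 0 < q := by linarith
  -- the normalized count
  have key : ∀ A : Finset F, |(PolyProg.progCount P A : ℝ) / q ^ 2 - ((A.card : ℝ) / q) ^ (m + 1)| ≤
      K * q ^ (-(1 / (N : ℝ))) := by
    intro A
    refine le_of_pow_le_pow_left₀ hN (by positivity) ((h F hF' A).trans (le_of_eq ?_))
    rw [mul_pow, hK, ← Real.rpow_natCast, ← Real.rpow_mul hC, ← Real.rpow_natCast,
      ← Real.rpow_mul hq0.le, neg_mul, one_div_mul_cancel hN'.ne', Real.rpow_one, Real.rpow_neg_one]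
    rfl
  have hpow : ((K + 1) * q ^ (-γ)) ^ (m + 1) = (K + 1) ^ (m + 1) * q ^ (-(1 / (N : ℝ))) := by
    rw [mul_pow, ← Real.rpow_natCast (q ^ (-γ)), ← Real.rpow_mul hq0.le, ← hγm]
    push_cast
    congr 2; ring
  constructor
  · obtain ⟨A, hA, hAr⟩ : ∃ A : Finset F, PolyProg.ProgFree P A ∧ PolyProg.r P F = A.card := by
      classical
      obtain ⟨A, hA, hAr⟩ := Finset.exists_mem_eq_sup
        ((Finset.univ : Finset (Finset F)).filter fun A => PolyProg.ProgFree P A)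
        ⟨∅, Finset.mem_filter.2 ⟨Finset.mem_univ _, fun x y _ hxy => by simpa using hxy.1⟩⟩
        Finset.card
      refine ⟨A, (Finset.mem_filter.1 hA).2, ?_⟩
      rw [← hAr, PolyProg.r]
    rw [hAr]
    have h1 : (PolyProg.progCount P A : ℝ) / q ^ 2 ≤ q ^ (-(1 / (N : ℝ))) := by
      have h2 : (PolyProg.progCount P A : ℝ) ≤ q := by
        rw [hq]; exact_mod_cast PolyProg.progCount_le_card hA
      calc (PolyProg.progCount P A : ℝ) / q ^ 2 ≤ q / q ^ 2 := by gcongr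
        _ = q ^ (-1 : ℝ) := by rw [Real.rpow_neg_one]; field_simp
        _ ≤ _ := by
            refine Real.rpow_le_rpow_of_exponent_le hq1 (neg_le_neg ?_)
            rw [div_le_one hN']
            exact_mod_cast Nat.one_le_iff_ne_zero.2 hN
    have h2 : ((A.card : ℝ) / q) ^ (m + 1) ≤ ((K + 1) * q ^ (-γ)) ^ (m + 1) := by
      rw [hpow]
      have h3 := (abs_le.1 (key A)).1
      have h4 : (K + 1) * q ^ (-(1 / (N : ℝ))) ≤ (K + 1) ^ (m + 1) * q ^ (-(1 / (N : ℝ))) := by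
        gcongr
        exact le_self_pow₀ (by linarith) (by omega)
      linarith
    have h3 := le_of_pow_le_pow_left₀ (Nat.succ_ne_zero m) (by positivity) h2
    rw [div_le_iff₀ hq0] at h3
    refine h3.trans (le_of_eq ?_)
    rw [mul_assoc, ← Real.rpow_add_one hq0.ne']
    congr 2; ring
  · intro A
    have h1 : (PolyProg.progCount P A : ℝ) - (A.card : ℝ) ^ (m + 1) / q ^ ((m : ℤ) - 1) =
        q ^ 2 * ((PolyProg.progCount P A : ℝ) / q ^ 2 - ((A.card : ℝ) / q) ^ (m + 1)) := by
      have h2 : q ^ ((m : ℤ) - 1) = q ^ (m + 1) / q ^ 2 := by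
        rw [show (m : ℤ) - 1 = ((m + 1 : ℕ) : ℤ) - ((2 : ℕ) : ℤ) by push_cast; ring,
          zpow_sub₀ hq0.ne', zpow_natCast, zpow_natCast]
      rw [h2, div_pow]
      field_simp
    rw [h1, abs_mul, abs_of_nonneg (sq_nonneg q), hγm]
    calc q ^ 2 * |(PolyProg.progCount P A : ℝ) / q ^ 2 - ((A.card : ℝ) / q) ^ (m + 1)|
        ≤ q ^ 2 * (K * q ^ (-(1 / (N : ℝ)))) := by gcongr; exact key A
      _ = K * q ^ (2 - 1 / (N : ℝ)) := by
          rw [sub_eq_add_neg, Real.rpow_add hq0, Real.rpow_two]; ring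
      _ ≤ (K + 1) * q ^ (2 - 1 / (N : ℝ)) := by gcongr; linarith
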